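/- Let $\gamma\in O(2)$ be the rotation of $\mathbf R^2$ about the origin through the angle $\pi/2$ and let $F=\langle\gamma\rangle$, a cyclic group of order $4$. Let $F'<O(2)$ be the Klein four-group generated by the reflections across the $x$-axis and the $y$-axis. Let $\Sigma=\mathbf Z^2\rtimes F$ and $\Sigma'=\mathbf Z^2\rtimes F'$, the groups of all motions $x\mapsto \sigma x+v$ with $v\in\mathbf Z^2$ and $\sigma\in F$, respectively $\sigma\in F'$. Both act properly discontinuously on $\mathbf R^2$; let $\mathcal O=\Sigma\backslash\mathbf R^2$ and $\mathcal O'=\Sigma'\backslash\mathbf R^2$ be the resulting closed flat orbifolds. A smooth $p$-form on $\mathcal O$ is a smooth $\Sigma$-invariant $p$-form on $\mathbf R^2$, and likewise for $\mathcal O'$. The $p$-spectrum of $\mathcal O$ (or $\mathcal O'$) is the sequence $0\le\lambda_1\le\lambda_2\le\dots\to\infty$ of eigenvalues, repeated according to multiplicity, of the Hodge Laplacian $d\delta+\delta d$ on $p$-forms, for which there is an orthonormal basis of the square-integrable $p$-forms that consists of smooth eigenforms. The $p$-spectrum of the square $Q=[0,\frac12]^2$ with absolute boundary conditions is defined in the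 same way, with eigenforms $\omega$ that are smooth up to the boundary and satisfy $j^*\iota_\nu\omega=0$ and $j^*\iota_\nu d\omega=0$ on every edge, where $\nu$ is a unit normal of the edge and $j$ its inclusion. Then: 1. $\mathcal O$ is a flat $3$-pillow: its underlying topological space is homeomorphic to the sphere $S^2$, and its singular set consists of exactly three points, namely two cone points of order $4$, the $\Sigma$-orbits of $(0,0)$ and $(\frac12,\frac12)$, and one cone point of order $2$, the $\Sigma$-orbit of $(\frac12,0)$, which is also that of $(0,\frac12)$. 2. The underlying space of $\mathcal O'$ is the square $Q$: the projection $\mathbf R^2\to\mathcal O'$ restricts to a homeomorphism of $Q$ onto the underlying space, which is isometric for the quotient metric, that is, $|x-y|\le|x-gy|$ for all $x,y\in Q$ and $g\in\Sigma'$. The interior points of $Q$ are regular points of $\mathcal O'$, the points of the edges other than the corners are reflector points, and the four corners are dihedral points, with isotropy group generated by reflections across two perpendicular lines. 3. $\mathcal O$ and $\mathcal O'$ are $1$-isospectral, and their common $1$-spectrum is the $1$-spectrum of $Q$ with absolute boundary conditions. In particular the $1$-spectrum of the $3$-pillow $\mathcal O$ equals the $1$-spectrum of the square with absolute boundary conditions.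 -/

import Mathlib

noncomputable section

namespace FlatOrbifold

open MeasureTheory Filter

/-! ### Euclidean motions of the plane and crystallographic groups -/

/-- The Euclidean plane. -/
abbrev Plane : Type := EuclideanSpace ℝ (Fin 2)

/-- The orthogonal group of the plane. -/
abbrev Orth : Type := Plane ≃ₗᵢ[ℝ] Plane

/-- The group of Euclidean motions of the plane. -/
abbrev Motion : Type := Plane ≃ᵃⁱ[ℝ] Plane

/-- The tautological action of the Euclidean motions on the plane. -/
instance : MulAction Motion Plane where
  smul g x := g x
  one_smul _ := rfl
  mul_smul _ _ _ := rfl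

/-- The projection of the motion group onto the orthogonal group. -/
def linearPart : Motion →* Orth where
  toFun g := g.linearIsometryEquiv
  map_one' := rfl
  map_mul' _ _ := rfl

/-- The integer lattice in the plane. -/
def intLattice : AddSubgroup Plane where
  carrier := {v | ∀ i, ∃ n : ℤ, v i = n}
  zero_mem' := fun _ => ⟨0, by simp⟩
  add_mem' := by
    intro a b ha hb i
    obtain ⟨m, hm⟩ := ha i
    obtain ⟨n, hn⟩ := hb i
    exact ⟨m + n, by simp [hm, hn]⟩
  neg_mem' := by
    intro a ha i
    obtain ⟨m, hm⟩ := ha i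
    exact ⟨-m, by simp [hm]⟩

theorem motion_apply (g : Motion) (x : Plane) : g x = linearPart g x + g 0 := by
  have h := g.map_vadd 0 x
  rw [vadd_eq_add, vadd_eq_add, add_zero] at h
  exact h

/-- The semidirect product of the integer lattice with a group `F` of orthogonal transformations
that preserve it: all motions `x ↦ γ x + v` with `γ ∈ F` and `v` in the lattice. -/
def latticeSemidirect (F : Subgroup Orth) (hF : ∀ γ ∈ F, ∀ v ∈ intLattice, γ v ∈ intLattice) :
    Subgroup Motion where
  carrier := {g | linearPart g ∈ F ∧ g 0 ∈ intLattice}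
  one_mem' := ⟨by rw [map_one]; exact F.one_mem, intLattice.zero_mem⟩
  mul_mem' := by
    rintro g h ⟨hg, hg0⟩ ⟨hh, hh0⟩
    refine ⟨by rw [map_mul]; exact F.mul_mem hg hh, ?_⟩
    change g (h 0) ∈ intLattice
    rw [motion_apply g]
    exact intLattice.add_mem (hF _ hg _ hh0) hg0
  inv_mem' := by
    rintro g ⟨hg, hg0⟩
    have hi : linearPart g⁻¹ ∈ F := by rw [map_inv]; exact F.inv_mem hg
    refine ⟨hi, ?_⟩
    have h : g⁻¹ (g 0) = 0 := g.symm_apply_apply 0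
    rw [motion_apply g⁻¹] at h
    rw [eq_neg_of_add_eq_zero_right h]
    exact intLattice.neg_mem (hF _ hi _ hg0)

/-- The underlying topological space of the orbifold `G \ ℝ²`. -/
abbrev Underlying (G : Subgroup Motion) : Type := Quotient (MulAction.orbitRel G Plane)

/-- The image in `G \ ℝ²` of a point of the plane. -/
def proj (G : Subgroup Motion) (x : Plane) : Underlying G := Quotient.mk _ x

/-! ### Isotropy -/

/-- Rotation about the origin through the angle `θ`. -/
def rotation (θ : ℝ) : Orth :=
  LinearIsometryEquiv.mk
    { toFun := fun x => !₂[Real.cos θ * x 0 - Real.sin θ * x 1, Real.sin θ * x 0 + Real.cos θ * x 1]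
      invFun := fun x =>
        !₂[Real.cos θ * x 0 + Real.sin θ * x 1, -Real.sin θ * x 0 + Real.cos θ * x 1]
      map_add' := by
        intro x y
        ext i
        fin_cases i <;> simp <;> ring
      map_smul' := by
        intro c x
        ext i
        fin_cases i <;> simp <;> ring
      left_inv := by
        intro x
        ext i
        fin_cases i
        · simp
          linear_combination (x 0) * Real.sin_sq_add_cos_sq θ
        · simp
          linear_combination (x 1) * Real.sin_sq_add_cos_sq θ
      right_inv := by
        intro x
        ext i
        fin_cases i
        · simp
          linear_combination (x 0) * Real.sin_sq_add_cos_sq θ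
        · simp
          linear_combination (x 1) * Real.sin_sq_add_cos_sq θ }
    (by
      intro x
      simp only [EuclideanSpace.norm_eq, Fin.sum_univ_two, Real.norm_eq_abs, sq_abs]
      congr 1
      simp
      linear_combination (x 0 ^ 2 + x 1 ^ 2) * Real.sin_sq_add_cos_sq θ)

/-- Reflection across the line through the origin that makes the angle `θ` with the `x`-axis. -/
def lineReflection (θ : ℝ) : Orth :=
  (Submodule.span ℝ {(!₂[Real.cos θ, Real.sin θ] : Plane)}).reflection

/-- The isotropy group of the image of `x` in `G \ ℝ²`, viewed inside the orthogonal group through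
the derivatives at `x` of the elements of the stabilizer of `x`. -/
def isotropy (G : Subgroup Motion) (x : Plane) : Subgroup Orth :=
  (G ⊓ MulAction.stabilizer Motion x).map linearPart

/-- The image of `x` in `G \ ℝ²` has the isotropy type (conjugacy class in the orthogonal group)
of `H`. -/
def HasIsotropyType (G : Subgroup Motion) (x : Plane) (H : Subgroup Orth) : Prop :=
  ∃ h : Orth, isotropy G x = H.map (MulAut.conj h).toMonoidHom

/-- The image of `x` in `G \ ℝ²` is a singular point. -/
def IsSingular (G : Subgroup Motion) (x : Plane) : Prop := isotropy G x ≠ ⊥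

/-- The image of `x` in `G \ ℝ²` is a cone point of order `k`. -/
def IsConePoint (G : Subgroup Motion) (k : ℕ) (x : Plane) : Prop :=
  2 ≤ k ∧ HasIsotropyType G x (Subgroup.zpowers (rotation (2 * Real.pi / k)))

/-- The image of `x` in `G \ ℝ²` lies on a reflector edge (a mirror). -/
def IsReflectorPoint (G : Subgroup Motion) (x : Plane) : Prop :=
  HasIsotropyType G x (Subgroup.zpowers (lineReflection 0))

/-- The image of `x` in `G \ ℝ²` is a dihedral point (a corner reflector): the isotropy group is
generated by reflections across two lines that form the angle `π / k`. -/
def IsDihedralPoint (G : Subgroup Motion) (k : ℕ) (x : Plane) : Prop :=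
  2 ≤ k ∧ HasIsotropyType G x
    (Subgroup.closure {lineReflection 0, lineReflection (Real.pi / k)})

/-! ### Differential forms and the Hodge Laplacian -/

/-- Differential `p`-forms on the plane (without any regularity). -/
abbrev Form (p : ℕ) : Type := Plane → Plane [⋀^Fin p]→L[ℝ] ℝ

/-- The standard orthonormal frame. -/
def frame (i : Fin 2) : Plane := EuclideanSpace.single i 1

/-- Pullback of a form by a Euclidean motion. -/
def pullback {p : ℕ} (g : Motion) (ω : Form p) : Form p := fun x =>
  (ω (g x)).compContinuousLinearMap (g.linearIsometryEquiv : Plane →L[ℝ] Plane)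

/-- The codifferential `δ` of the flat metric, `δω = - ∑ᵢ ι(eᵢ) ∇_{eᵢ} ω`. -/
def codiff {p : ℕ} (ω : Form (p + 1)) : Form p := fun x =>
  -∑ i, (fderiv ℝ ω x (frame i)).curryLeft (frame i)

/-- The (nonnegative) Hodge Laplacian `dδ + δd`; on functions `δ` vanishes. -/
def hodgeLaplacian : {p : ℕ} → Form p → Form p
  | 0, ω => codiff (extDeriv ω)
  | _ + 1, ω => fun x => extDeriv (codiff ω) x + codiff (extDeriv ω) x

/-- The pointwise inner product of `p`-forms, for which the `dx^J` with increasing multi-indices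
`J` are orthonormal. -/
def formInner {p : ℕ} (a b : Plane [⋀^Fin p]→L[ℝ] ℝ) : ℝ :=
  (p.factorial : ℝ)⁻¹ * ∑ J : Fin p → Fin 2, a (fun k => frame (J k)) * b (fun k => frame (J k))

/-! ### Spectra -/

/-- `lam 0 ≤ lam 1 ≤ ⋯ → ∞` is the list of eigenvalues, repeated according to multiplicity, for the
eigenvalue problem on `D` whose smooth eigenforms with eigenvalue `μ` are the elements of `Eig μ`:
there are eigenforms with these eigenvalues that form an orthonormal basis of the Hilbert space of
square-integrable `p`-forms on `D`. -/
def IsEigenvalueList {p : ℕ} (D : Set Plane) (Eig : ℝ → Set (Form p)) (lam : ℕ → ℝ) : Prop :=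
  (∀ i, 0 ≤ lam i) ∧ Monotone lam ∧ Tendsto lam atTop atTop ∧
  ∃ φ : ℕ → Form p,
    (∀ i, φ i ∈ Eig (lam i)) ∧
    (∀ i, MemLp (φ i) 2 (volume.restrict D)) ∧
    (∀ i j, ∫ x in D, formInner (φ i x) (φ j x) = if i = j then 1 else 0) ∧
    ∀ ω : Form p, MemLp ω 2 (volume.restrict D) →
      (∀ i, ∫ x in D, formInner (ω x) (φ i x) = 0) → ω =ᵐ[volume.restrict D] 0

/-- The smooth eigenforms with eigenvalue `μ` of the Hodge Laplacian on `p`-forms of the orbifold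
`G \ ℝ²`, identified with their lifts to `ℝ²`. -/
def orbifoldEigenforms (p : ℕ) (G : Subgroup Motion) (μ : ℝ) : Set (Form p) :=
  {ω | ContDiff ℝ ((⊤ : ℕ∞) : WithTop ℕ∞) ω ∧ (∀ g ∈ G, pullback g ω = ω) ∧ ∀ x, hodgeLaplacian ω x = μ • ω x}

/-- `lam` is the `p`-spectrum of the orbifold `G \ ℝ²`. Square-integrable forms on the orbifold are
square-integrable forms on a fundamental domain `D` of `G`. -/
def IsOrbifoldSpectrum (p : ℕ) (G : Subgroup Motion) (lam : ℕ → ℝ) : Prop :=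
  ∃ D : Set Plane, IsFundamentalDomain G D ∧ IsEigenvalueList D (orbifoldEigenforms p G) lam

/-- The closed square `[0, 1/2] × [0, 1/2]`. -/
def square : Set Plane := {x | ∀ i, 0 ≤ x i ∧ x i ≤ 1 / 2}

/-- `x` lies on one of the two edges of the square that are orthogonal to `frame i`. -/
def OnEdge (i : Fin 2) (x : Plane) : Prop := x ∈ square ∧ (x i = 0 ∨ x i = 1 / 2)

/-- The pullback `j^* ι_ν a` to an edge orthogonal to the unit vector `ν` of the contraction
of `a` with `ν`. -/
def normalPart {p : ℕ} (ν : Plane) (a : Plane [⋀^Fin (p + 1)]→L[ℝ] ℝ) :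
    (Submodule.span ℝ {ν})ᗮ [⋀^Fin p]→L[ℝ] ℝ :=
  (a.curryLeft ν).compContinuousLinearMap (Submodule.span ℝ {ν})ᗮ.subtypeL

/-- The absolute boundary conditions `j^* ι_ν ω = j^* ι_ν dω = 0` on the edges of the square
(for functions the first one is void). -/
def AbsoluteBoundary : {p : ℕ} → Form p → Prop
  | 0, ω => ∀ i x, OnEdge i x → normalPart (frame i) (extDeriv ω x) = 0
  | _ + 1, ω => ∀ i x, OnEdge i x →
      normalPart (frame i) (ω x) = 0 ∧ normalPart (frame i) (extDeriv ω x) = 0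

/-- The eigenforms with eigenvalue `μ` of the Hodge Laplacian on `p`-forms of the closed square with
absolute boundary conditions. Forms that are smooth up to the boundary are given by a smooth
extension to the plane; only the restriction to the square matters. -/
def squareEigenforms (p : ℕ) (μ : ℝ) : Set (Form p) :=
  {ω | ContDiff ℝ ((⊤ : ℕ∞) : WithTop ℕ∞) ω ∧ AbsoluteBoundary ω ∧ ∀ x ∈ square, hodgeLaplacian ω x = μ • ω x}

/-- `lam` is the `p`-spectrum of the square with absolute boundary conditions. -/
def IsSquareAbsoluteSpectrum (p : ℕ) (lam : ℕ → ℝ) : Prop :=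
  IsEigenvalueList square (squareEigenforms p) lam

/-! ### The two orbifolds -/

/-- The group generated by the rotation about the origin through `π / 2`. -/
def rotGroup : Subgroup Orth := Subgroup.zpowers (rotation (Real.pi / 2))

/-- The group generated by the reflections across the `x`-axis and the `y`-axis. -/
def kleinGroup : Subgroup Orth :=
  Subgroup.closure {(Submodule.span ℝ {frame 0}).reflection,
    (Submodule.span ℝ {frame 1}).reflection}

theorem rotGroup_preserves : ∀ γ ∈ rotGroup, ∀ v ∈ intLattice, γ v ∈ intLattice := by
  intro γ hγ
  rw [rotGroup, Subgroup.zpowers_eq_closure] at hγ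
  have key : ∀ v : Plane, rotation (Real.pi / 2) v = !₂[-v 1, v 0] := by
    intro v
    ext i
    fin_cases i <;> simp [rotation]
  have keyi : ∀ v : Plane, (rotation (Real.pi / 2))⁻¹ v = !₂[v 1, -v 0] := by
    intro v
    apply (rotation (Real.pi / 2)).injective
    change rotation (Real.pi / 2) ((rotation (Real.pi / 2)).symm v) = _
    rw [LinearIsometryEquiv.apply_symm_apply, key]
    ext i
    fin_cases i <;> simp
  refine Subgroup.closure_induction'' (p := fun γ _ => ∀ v ∈ intLattice, γ v ∈ intLattice)
    ?_ ?_ ?_ ?_ hγ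
  · intro x hx v hv i
    rw [Set.mem_singleton_iff] at hx
    subst hx
    rw [key]
    obtain ⟨m, hm⟩ := hv 0
    obtain ⟨n, hn⟩ := hv 1
    fin_cases i
    · exact ⟨-n, by simp [hn]⟩
    · exact ⟨m, by simp [hm]⟩
  · intro x hx v hv i
    rw [Set.mem_singleton_iff] at hx
    subst hx
    rw [keyi]
    obtain ⟨m, hm⟩ := hv 0
    obtain ⟨n, hn⟩ := hv 1
    fin_cases i
    · exact ⟨n, by simp [hn]⟩
    · exact ⟨-m, by simp [hm]⟩
  · intro v hv
    exact hv
  · intro x y _ _ hx hy v hv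
    exact hx _ (hy v hv)

theorem kleinGroup_preserves : ∀ γ ∈ kleinGroup, ∀ v ∈ intLattice, γ v ∈ intLattice := by
  intro γ hγ
  have key : ∀ j : Fin 2, ∀ v ∈ intLattice,
      (Submodule.span ℝ {frame j}).reflection v ∈ intLattice := by
    intro j v hv i
    rw [Submodule.reflection_singleton_apply]
    obtain ⟨m, hm⟩ := hv i
    obtain ⟨n, hn⟩ := hv j
    by_cases hij : i = j
    · subst hij
      exact ⟨m, by simp [frame, hm, EuclideanSpace.inner_single_left]; ring⟩
    · exact ⟨-m, by simp [frame, hm, hij, EuclideanSpace.inner_single_left]⟩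
  refine Subgroup.closure_induction'' (p := fun γ _ => ∀ v ∈ intLattice, γ v ∈ intLattice)
    ?_ ?_ ?_ ?_ hγ
  · rintro x (rfl | rfl)
    · exact key 0
    · exact key 1
  · rintro x (rfl | rfl)
    · rw [Submodule.reflection_inv]
      exact key 0
    · rw [Submodule.reflection_inv]
      exact key 1
  · intro v hv
    exact hv
  · intro x y _ _ hx hy v hv
    exact hx _ (hy v hv)

/-- The crystallographic group `ℤ² ⋊ C₄`. -/
def pillowGroup : Subgroup Motion := latticeSemidirect rotGroup rotGroup_preserves

/-- The crystallographic group `ℤ² ⋊ V₄`. -/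
def squareGroup : Subgroup Motion := latticeSemidirect kleinGroup kleinGroup_preserves

end FlatOrbifold

end

/-!
In the coordinates of `ℝ²` the elements of `squareGroup` act by `xᵢ ↦ ± xᵢ + nᵢ`, so `[0, 1/2]` is a
strict fundamental domain for each coordinate and the reflections across the edges of the square
force invariant forms to satisfy the absolute boundary conditions; the invariant `1`-forms
`sin (2 π m xⱼ) cos (2 π n xₖ) dxⱼ` span. The spectrum of the pillow follows by transplantation:
on the square, `(a, b) ↦ (a + b, (a - b) ∘ swap) / √2` is an isometry of `L²` forms that carries
invariant eigenforms of `squareGroup` to those of `pillowGroup`. The pillow itself is identified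
with a sphere through `cos (2 π x)` and `cos (2 π y)`, sorted by size: they parametrize a triangle,
two copies of which, glued along their boundaries, form the boundary of a convex body.
-/

noncomputable section

namespace FlatOrbifold

open MeasureTheory Filter Laplacian

/-! ### The action of `ℤ ⋊ {±1}` on the line -/

theorem exists_unit_mul_add_int_mem_Icc (t : ℝ) :
    ∃ (ε : ℤˣ) (n : ℤ), (ε : ℝ) * t + n ∈ Set.Icc (0 : ℝ) (1 / 2) := by
  have h := abs_le.1 (abs_sub_round t)
  rcases le_total 0 (t - round t) with h0 | h0
  · exact ⟨1, -round t, by push_cast; constructor <;> linarith⟩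
  · exact ⟨-1, round t, by push_cast; constructor <;> linarith⟩

theorem eq_one_and_eq_zero_of_mul_add_int_mem_Icc {t : ℝ} (ht : t ∈ Set.Ioo (0 : ℝ) (1 / 2))
    {ε : ℤˣ} {n : ℤ} (h : (ε : ℝ) * t + n ∈ Set.Icc (0 : ℝ) (1 / 2)) : ε = 1 ∧ n = 0 := by
  obtain ⟨h0, h1⟩ := ht
  obtain ⟨h2, h3⟩ := h
  have hn : n < 1 ∧ -1 < n := by
    constructor <;> rify <;> rcases Int.units_eq_one_or ε with rfl | rfl <;> push_cast at * <;>
      linarith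
  obtain rfl : n = 0 := by lia
  rcases Int.units_eq_one_or ε with rfl | rfl
  · exact ⟨rfl, rfl⟩
  · push_cast at h2
    linarith

theorem abs_sub_le_abs_sub_mul_add_int {a b : ℝ} (ha : a ∈ Set.Icc (0 : ℝ) (1 / 2))
    (hb : b ∈ Set.Icc (0 : ℝ) (1 / 2)) (ε : ℤˣ) (n : ℤ) :
    |a - b| ≤ |a - ((ε : ℝ) * b + n)| := by
  obtain ⟨ha0, ha1⟩ := ha
  obtain ⟨hb0, hb1⟩ := hb
  have hn : (n : ℝ) ≤ -1 ∨ n = 0 ∨ (1 : ℝ) ≤ n := by norm_cast; lia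
  rcases Int.units_eq_one_or ε with rfl | rfl <;> push_cast <;> rcases hn with hn | rfl | hn <;>
    push_cast <;> grind

theorem exists_two_mul_eq_int_iff_eq_zero_or {t : ℝ} (ht : t ∈ Set.Icc (0 : ℝ) (1 / 2)) :
    (∃ n : ℤ, 2 * t = n) ↔ t = 0 ∨ t = 1 / 2 := by
  constructor
  · rintro ⟨n, hn⟩
    have h0 : (0 : ℝ) ≤ n := by linarith [ht.1]
    have h1 : (n : ℝ) ≤ 1 := by linarith [ht.2]
    norm_cast at h0 h1
    obtain rfl | rfl : n = 0 ∨ n = 1 := by lia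
    · exact Or.inl (by push_cast at hn; linarith)
    · exact Or.inr (by push_cast at hn; linarith)
  · rintro (rfl | rfl)
    · exact ⟨0, by simp⟩
    · exact ⟨1, by norm_num⟩

theorem exists_sub_unit_mul_eq_int_iff {ε : ℤˣ} {t : ℝ} :
    (∃ n : ℤ, t - ε * t = n) ↔ ε = 1 ∨ ∃ n : ℤ, 2 * t = n := by
  rcases Int.units_eq_one_or ε with rfl | rfl
  · simpa using ⟨0, by simp⟩
  · simp [two_mul]

/-! ### Motions and orbits -/

theorem mem_intLattice {v : Plane} : v ∈ intLattice ↔ ∃ n : Fin 2 → ℤ, ∀ i, v i = n i :=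
  Classical.skolem

/-- The motion `x ↦ γ x + v`. -/
def motionOf (γ : Orth) (v : Plane) : Motion :=
  AffineIsometryEquiv.constVAdd ℝ Plane v * γ.toAffineIsometryEquiv

@[simp]
theorem motionOf_apply (γ : Orth) (v x : Plane) : motionOf γ v x = γ x + v :=
  add_comm v (γ x)

theorem motionOf_linearPart (g : Motion) : motionOf (linearPart g) (g 0) = g := by
  ext1 x
  rw [motionOf_apply, ← motion_apply]

@[simp]
theorem linearPart_motionOf (γ : Orth) (v : Plane) : linearPart (motionOf γ v) = γ := by
  ext1 x
  have h := motion_apply (motionOf γ v) x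
  rw [motionOf_apply, motionOf_apply, map_zero, zero_add] at h
  exact (add_right_cancel h).symm

theorem proj_eq_iff {G : Subgroup Motion} {x y : Plane} :
    proj G x = proj G y ↔ ∃ g ∈ G, g y = x := by
  rw [proj, proj, Quotient.eq]
  exact ⟨fun ⟨g, hg⟩ => ⟨g, g.2, hg⟩, fun ⟨g, hg, h⟩ => ⟨⟨g, hg⟩, h⟩⟩

theorem continuous_proj (G : Subgroup Motion) : Continuous (proj G) := continuous_quotient_mk'

instance (G : Subgroup Motion) : ContinuousConstSMul G Plane :=
  ⟨fun g => (g : Motion).continuous⟩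

theorem compactSpace_underlying {G : Subgroup Motion} {K : Set Plane} (hK : IsCompact K)
    (hcov : ∀ x, ∃ g ∈ G, g x ∈ K) : CompactSpace (Underlying G) := by
  refine ⟨(hK.image (continuous_proj G)).of_isClosed_subset isClosed_univ fun q _ => ?_⟩
  obtain ⟨x, rfl⟩ := Quotient.exists_rep q
  obtain ⟨g, hg, hgx⟩ := hcov x
  exact ⟨g x, hgx, proj_eq_iff.2 ⟨g, hg, rfl⟩⟩

theorem finite_intLattice_inter_closedBall (R : ℝ) :
    ((intLattice : Set Plane) ∩ Metric.closedBall 0 R).Finite := by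
  have hbox : (Set.Icc (fun _ => -⌈R⌉) fun _ => ⌈R⌉ : Set (Fin 2 → ℤ)).Finite := Set.finite_Icc _ _
  refine (hbox.image fun n => WithLp.toLp 2 fun i => (n i : ℝ)).subset ?_
  rintro v ⟨hv, hR⟩
  obtain ⟨n, hn⟩ := mem_intLattice.1 hv
  have hb (i : Fin 2) : |n i| ≤ ⌈R⌉ := by
    rify
    rw [← hn]
    exact (PiLp.norm_apply_le v i).trans ((mem_closedBall_zero_iff.1 hR).trans (Int.le_ceil R))
  exact ⟨n, ⟨fun i => (abs_le.1 (hb i)).1, fun i => (abs_le.1 (hb i)).2⟩,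
    PiLp.ext fun i => (hn i).symm⟩

section LatticeSemidirect

variable {F : Subgroup Orth} {hF : ∀ γ ∈ F, ∀ v ∈ intLattice, γ v ∈ intLattice}

theorem motionOf_mem_latticeSemidirect {γ : Orth} (hγ : γ ∈ F) {v : Plane}
    (hv : v ∈ intLattice) : motionOf γ v ∈ latticeSemidirect F hF := by
  refine ⟨by rwa [linearPart_motionOf], ?_⟩
  rwa [motionOf_apply, map_zero, zero_add]

theorem mem_latticeSemidirect {g : Motion} :
    g ∈ latticeSemidirect F hF ↔ ∃ γ ∈ F, ∃ v ∈ intLattice, g = motionOf γ v := by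
  constructor
  · exact fun hg => ⟨_, hg.1, _, hg.2, (motionOf_linearPart g).symm⟩
  · rintro ⟨γ, hγ, v, hv, rfl⟩
    exact motionOf_mem_latticeSemidirect hγ hv

theorem mem_isotropy_latticeSemidirect {x : Plane} {γ : Orth} :
    γ ∈ isotropy (latticeSemidirect F hF) x ↔ γ ∈ F ∧ x - γ x ∈ intLattice := by
  constructor
  · rintro ⟨g, ⟨hg, hx⟩, rfl⟩
    have hx : linearPart g x + g 0 = x := (motion_apply g x).symm.trans hx
    exact ⟨hg.1, (eq_sub_of_add_eq' hx) ▸ hg.2⟩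
  · rintro ⟨hγ, hx⟩
    refine ⟨motionOf γ (x - γ x), ⟨motionOf_mem_latticeSemidirect hγ hx, ?_⟩,
      linearPart_motionOf _ _⟩
    change motionOf γ (x - γ x) x = x
    rw [motionOf_apply, add_sub_cancel]

theorem properlyDiscontinuousSMul_latticeSemidirect [Finite F] :
    ProperlyDiscontinuousSMul (latticeSemidirect F hF) Plane := by
  refine ⟨fun {K L} hK hL => ?_⟩
  obtain ⟨a, ha⟩ := hK.isBounded.exists_norm_le
  obtain ⟨b, hb⟩ := hL.isBounded.exists_norm_le
  have hfin := (Set.toFinite (F : Set Orth)).prod (finite_intLattice_inter_closedBall (a + b))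
  refine ((hfin.image fun p => motionOf p.1 p.2).preimage Subtype.val_injective.injOn).subset ?_
  rintro ⟨g, hg⟩ ⟨_, ⟨x, hx, rfl⟩, hgx⟩
  refine ⟨(linearPart g, g 0), ⟨hg.1, hg.2, mem_closedBall_zero_iff.2 ?_⟩, motionOf_linearPart g⟩
  have hgx : ‖g x‖ ≤ b := hb _ hgx
  calc ‖g 0‖ = ‖g x - linearPart g x‖ := by rw [motion_apply g x, add_sub_cancel_left]
    _ ≤ ‖g x‖ + ‖linearPart g x‖ := norm_sub_le _ _
    _ = ‖g x‖ + ‖x‖ := by rw [LinearIsometryEquiv.norm_map]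
    _ ≤ a + b := by linarith [ha x hx]

end LatticeSemidirect

theorem hasIsotropyType_isotropy (G : Subgroup Motion) (x : Plane) :
    HasIsotropyType G x (isotropy G x) :=
  ⟨1, by rw [map_one]; exact (Subgroup.map_id _).symm⟩

/-! ### The two holonomy groups -/

/-- The isometry of `ℝ^ι` that multiplies the `i`-th coordinate by the sign `ε i`. -/
def signChange {ι : Type*} [Fintype ι] :
    (ι → ℤˣ) →* (EuclideanSpace ℝ ι ≃ₗᵢ[ℝ] EuclideanSpace ℝ ι) where
  toFun ε := LinearIsometryEquiv.piLpCongrRight 2 fun i =>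
    if ε i = 1 then LinearIsometryEquiv.refl ℝ ℝ else LinearIsometryEquiv.neg ℝ
  map_one' := by ext; simp
  map_mul' ε δ := by
    ext x i
    rcases Int.units_eq_one_or (ε i) with hε | hε <;>
      rcases Int.units_eq_one_or (δ i) with hδ | hδ <;> simp [hε, hδ]

@[simp]
theorem signChange_apply {ι : Type*} [Fintype ι] (ε : ι → ℤˣ) (x : EuclideanSpace ℝ ι) (i : ι) :
    signChange ε x i = ε i * x i := by
  rcases Int.units_eq_one_or (ε i) with hε | hε <;> simp [signChange, hε]

theorem signChange_injective {ι : Type*} [Fintype ι] :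
    Function.Injective (signChange (ι := ι)) := by
  classical
  intro ε δ h
  ext i
  have := congrArg (fun γ => γ (EuclideanSpace.single i (1 : ℝ)) i) h
  simpa using this

/-- The rotation through a right angle. -/
def quarterTurn : Orth := rotation (Real.pi / 2)

@[simp]
theorem quarterTurn_apply_zero (x : Plane) : quarterTurn x 0 = -x 1 := by
  simp [quarterTurn, rotation]

@[simp]
theorem quarterTurn_apply_one (x : Plane) : quarterTurn x 1 = x 0 := by
  simp [quarterTurn, rotation]

theorem quarterTurn_mul_self : quarterTurn * quarterTurn = signChange (-1) := by
  ext x i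
  fin_cases i <;> simp

theorem signChange_neg_one_ne_one : signChange (-1 : Fin 2 → ℤˣ) ≠ 1 := fun h =>
  absurd (congrFun (signChange_injective (h.trans (map_one _).symm)) 0) (by decide)

theorem orderOf_quarterTurn : orderOf quarterTurn = 4 := by
  refine orderOf_eq_prime_pow (p := 2) (n := 1) ?_ ?_
  · rw [pow_one, pow_two, quarterTurn_mul_self]
    exact signChange_neg_one_ne_one
  · rw [pow_two, pow_mul, pow_two quarterTurn, quarterTurn_mul_self, ← map_pow, neg_one_sq, map_one]

theorem card_rotGroup : Nat.card rotGroup = 4 :=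
  (Nat.card_zpowers _).trans orderOf_quarterTurn

instance : IsCyclic rotGroup := inferInstanceAs (IsCyclic (Subgroup.zpowers quarterTurn))

instance : Finite rotGroup := Nat.finite_of_card_ne_zero (by simp [card_rotGroup])

theorem mem_rotGroup {γ : Orth} : γ ∈ rotGroup ↔
    ∃ ε : ℤˣ, γ = signChange (fun _ => ε) ∨ γ = signChange (fun _ => ε) * quarterTurn := by
  have heven (k : ℤ) : quarterTurn ^ (2 * k) = signChange fun _ => (-1) ^ k := by
    rw [zpow_mul, zpow_two, quarterTurn_mul_self, ← map_zpow]
    rfl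
  constructor
  · rintro ⟨n, rfl⟩
    obtain ⟨k, rfl | rfl⟩ := Int.even_or_odd' n
    · exact ⟨(-1) ^ k, Or.inl (heven k)⟩
    · exact ⟨(-1) ^ k, Or.inr ((zpow_add_one _ _).trans (congrArg (· * quarterTurn) (heven k)))⟩
  · have hmem : quarterTurn ∈ rotGroup := Subgroup.mem_zpowers _
    have hsign (ε : ℤˣ) : signChange (fun _ => ε) ∈ rotGroup := by
      rcases Int.units_eq_one_or ε with rfl | rfl
      · exact map_one (signChange (ι := Fin 2)) ▸ one_mem _
      · exact quarterTurn_mul_self ▸ mul_mem hmem hmem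
    rintro ⟨ε, rfl | rfl⟩
    exacts [hsign ε, mul_mem (hsign ε) hmem]

theorem reflection_span_frame (j : Fin 2) :
    (Submodule.span ℝ {frame j}).reflection = signChange (Function.update (-1) j 1) := by
  ext x i
  rw [Submodule.reflection_singleton_apply]
  by_cases hij : i = j
  · subst hij
    simp [frame, EuclideanSpace.inner_single_left]
    ring
  · simp [frame, EuclideanSpace.inner_single_left, hij]

theorem kleinGroup_eq_range_signChange : kleinGroup = signChange.range := by
  apply le_antisymm
  · rw [kleinGroup, Subgroup.closure_le]
    rintro _ (rfl | rfl) <;> exact ⟨_, (reflection_span_frame _).symm⟩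
  · have hgen (j : Fin 2) : signChange (Function.update (-1) j 1) ∈ kleinGroup := by
      rw [← reflection_span_frame]
      exact Subgroup.subset_closure (by fin_cases j <;> simp)
    rintro _ ⟨ε, rfl⟩
    have hcases : ε = 1 ∨ ε = Function.update (-1) 0 1 ∨ ε = Function.update (-1) 1 1 ∨
        ε = Function.update (-1) 0 1 * Function.update (-1) 1 1 := by
      revert ε; decide
    rcases hcases with rfl | rfl | rfl | rfl
    · rw [map_one]
      exact one_mem _
    · exact hgen 0
    · exact hgen 1
    · rw [map_mul]
      exact mul_mem (hgen 0) (hgen 1)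

theorem isKleinFour_kleinGroup : IsKleinFour kleinGroup := by
  have e : (Fin 2 → ℤˣ) ≃* kleinGroup :=
    (MonoidHom.ofInjective signChange_injective).trans
      (MulEquiv.subgroupCongr kleinGroup_eq_range_signChange.symm)
  refine ⟨by rw [← Nat.card_congr e.toEquiv, Nat.card_eq_fintype_card]; rfl, ?_⟩
  rw [← Monoid.exponent_eq_of_mulEquiv e]
  have hdvd : Monoid.exponent (Fin 2 → ℤˣ) ∣ 2 :=
    Monoid.exponent_dvd_of_forall_pow_eq_one fun ε => funext fun i => Int.units_sq _
  refine ((Nat.dvd_prime Nat.prime_two).1 hdvd).resolve_left fun h => ?_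
  have := Monoid.exp_eq_one_iff.1 h
  exact absurd (Subsingleton.elim (-1 : Fin 2 → ℤˣ) 1) (by decide)

instance : Finite kleinGroup := by
  rw [kleinGroup_eq_range_signChange]
  exact Finite.of_surjective _ signChange.rangeRestrict_surjective

theorem mem_pillowGroup {g : Motion} : g ∈ pillowGroup ↔ ∃ (ε : ℤˣ) (n : Fin 2 → ℤ),
    (∀ x i, g x i = ε * x i + n i) ∨ ∀ x i, g x i = ε * quarterTurn x i + n i := by
  rw [pillowGroup, mem_latticeSemidirect]
  constructor
  · rintro ⟨γ, hγ, v, hv, rfl⟩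
    obtain ⟨n, hn⟩ := mem_intLattice.1 hv
    obtain ⟨ε, rfl | rfl⟩ := mem_rotGroup.1 hγ
    · exact ⟨ε, n, Or.inl fun x i => by simp [hn]⟩
    · exact ⟨ε, n, Or.inr fun x i => by simp [hn]⟩
  · rintro ⟨ε, n, h | h⟩
    · exact ⟨_, mem_rotGroup.2 ⟨ε, Or.inl rfl⟩, WithLp.toLp 2 fun i => n i,
        mem_intLattice.2 ⟨n, fun _ => rfl⟩, by ext x i; simp [h]⟩
    · exact ⟨_, mem_rotGroup.2 ⟨ε, Or.inr rfl⟩, WithLp.toLp 2 fun i => n i,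
        mem_intLattice.2 ⟨n, fun _ => rfl⟩, by ext x i; simp [h]⟩

theorem mem_squareGroup {g : Motion} : g ∈ squareGroup ↔
    ∃ (ε : Fin 2 → ℤˣ) (n : Fin 2 → ℤ), ∀ x i, g x i = ε i * x i + n i := by
  rw [squareGroup, mem_latticeSemidirect, kleinGroup_eq_range_signChange]
  constructor
  · rintro ⟨_, ⟨ε, rfl⟩, v, hv, rfl⟩
    obtain ⟨n, hn⟩ := mem_intLattice.1 hv
    exact ⟨ε, n, fun x i => by simp [hn]⟩
  · rintro ⟨ε, n, h⟩
    exact ⟨_, ⟨ε, rfl⟩, WithLp.toLp 2 fun i => n i, mem_intLattice.2 ⟨n, fun _ => rfl⟩, by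
      ext x i; simp [h]⟩

/-! ### The square as a fundamental domain -/

theorem isCompact_square : IsCompact square := by
  have h : square = EuclideanSpace.equiv (Fin 2) ℝ ⁻¹' Set.Icc (fun _ => 0) fun _ => 1 / 2 :=
    Set.ext fun _ => forall_and
  rw [h]
  exact (EuclideanSpace.equiv (Fin 2) ℝ).toHomeomorph.isCompact_preimage.2 isCompact_Icc

theorem measurableSet_square : MeasurableSet square := isCompact_square.isClosed.measurableSet

theorem mem_Ioo_of_not_onEdge {x : Plane} (hx : x ∈ square) {i : Fin 2} (h : ¬OnEdge i x) :
    x i ∈ Set.Ioo (0 : ℝ) (1 / 2) :=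
  ⟨(hx i).1.lt_of_ne' fun h0 => h ⟨hx, Or.inl h0⟩, (hx i).2.lt_of_ne fun h1 => h ⟨hx, Or.inr h1⟩⟩

theorem exists_mem_squareGroup_apply_mem_square (x : Plane) : ∃ g ∈ squareGroup, g x ∈ square := by
  choose ε n h using fun i => exists_unit_mul_add_int_mem_Icc (x i)
  let g := motionOf (signChange ε) (WithLp.toLp 2 fun i => (n i : ℝ))
  exact ⟨g, mem_squareGroup.2 ⟨ε, n, by simp [g]⟩, fun i => by simpa [g] using h i⟩

theorem exists_mem_pillowGroup_apply_mem_square (x : Plane) : ∃ g ∈ pillowGroup, g x ∈ square := by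
  choose ε n h using fun i => exists_unit_mul_add_int_mem_Icc (x i)
  by_cases hε : ε 0 = ε 1
  · let g := motionOf (signChange fun _ => ε 0) (WithLp.toLp 2 fun i => (n i : ℝ))
    refine ⟨g, mem_pillowGroup.2 ⟨ε 0, n, Or.inl (by simp [g])⟩, fun i => ?_⟩
    fin_cases i
    · simpa [g] using h 0
    · simpa [g, hε] using h 1
  · let g := motionOf ((signChange fun _ => ε 0) * quarterTurn) !₂[(n 1 : ℝ), (n 0 : ℝ)]
    refine ⟨g, mem_pillowGroup.2 ⟨ε 0, ![n 1, n 0], Or.inr fun y i => ?_⟩, fun i => ?_⟩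
    · fin_cases i <;> simp [g]
    · fin_cases i
      · simpa [g, Int.units_ne_iff_eq_neg.1 hε] using h 1
      · simpa [g] using h 0

theorem eq_one_of_mem_squareGroup {x : Plane} (hx : ∀ i, x i ∈ Set.Ioo (0 : ℝ) (1 / 2))
    {g : Motion} (hg : g ∈ squareGroup) (hgx : g x ∈ square) : g = 1 := by
  obtain ⟨ε, n, h⟩ := mem_squareGroup.1 hg
  have hid (i : Fin 2) := eq_one_and_eq_zero_of_mul_add_int_mem_Icc (hx i) (h x i ▸ hgx i)
  ext y i
  simp [h, hid i]

theorem eq_one_of_mem_pillowGroup {x : Plane} (hx : ∀ i, x i ∈ Set.Ioo (0 : ℝ) (1 / 2))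
    {g : Motion} (hg : g ∈ pillowGroup) (hgx : g x ∈ square) : g = 1 := by
  obtain ⟨ε, n, h | h⟩ := mem_pillowGroup.1 hg
  · have hid (i : Fin 2) := eq_one_and_eq_zero_of_mul_add_int_mem_Icc (hx i) (h x i ▸ hgx i)
    ext y i
    simp [h, hid i]
  · have h0 := eq_one_and_eq_zero_of_mul_add_int_mem_Icc (hx 1) (ε := -ε) (n := n 0)
      (by simpa [h] using hgx 0)
    have h1 := eq_one_and_eq_zero_of_mul_add_int_mem_Icc (hx 0) (ε := ε) (n := n 1)
      (by simpa [h] using hgx 1)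
    exact absurd (h1.1 ▸ h0.1) (by decide)

theorem volume_setOf_coord_eq {ι : Type*} [Fintype ι] (i : ι) (c : ℝ) :
    volume {x : EuclideanSpace ℝ ι | x i = c} = 0 := by
  have hs : MeasurableSet {y : ι → ℝ | y i = c} :=
    measurableSet_eq_fun (measurable_pi_apply i) measurable_const
  have h0 : volume {y : ι → ℝ | y i = c} = 0 :=
    Measure.pi_hyperplane (fun _ : ι => (volume : Measure ℝ)) i c
  exact ((EuclideanSpace.volume_preserving_symm_measurableEquiv_toLp ι).measure_preimage
    hs.nullMeasurableSet).trans h0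

theorem volume_setOf_onEdge (i : Fin 2) : volume {x : Plane | OnEdge i x} = 0 :=
  measure_mono_null (t := {x : Plane | x i = 0} ∪ {x | x i = 1 / 2}) (fun _ hx => hx.2)
    (measure_union_null (volume_setOf_coord_eq i 0) (volume_setOf_coord_eq i (1 / 2)))

theorem ae_forall_not_onEdge : ∀ᵐ x : Plane, ∀ i, ¬OnEdge i x :=
  ae_all_iff.2 fun i => measure_eq_zero_iff_ae_notMem.1 (volume_setOf_onEdge i)

theorem measurePreserving_motion (g : Motion) : MeasurePreserving g volume volume := by
  have h := (measurePreserving_add_right volume (g 0)).comp (linearPart g).measurePreserving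
  rwa [show (· + g 0) ∘ linearPart g = g from funext fun x => (motion_apply g x).symm] at h

open scoped Pointwise in
theorem isFundamentalDomain_of_forall_ae {G : Subgroup Motion} {D : Set Plane}
    (hD : NullMeasurableSet D) (hcov : ∀ᵐ x, ∃ g ∈ G, g x ∈ D)
    (huniq : ∀ᵐ x, x ∈ D → ∀ g ∈ G, g x ∈ D → g = 1) : IsFundamentalDomain G D := by
  refine IsFundamentalDomain.mk'' hD ?_ (fun g hg => ?_)
    fun g => (measurePreserving_motion (g : Motion)).quasiMeasurePreserving
  · filter_upwards [hcov] with x ⟨g, hg, hx⟩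
    exact ⟨⟨g, hg⟩, hx⟩
  · refine measure_mono_null ?_ huniq
    rintro x ⟨hgx, hx⟩ h
    rw [Set.mem_smul_set_iff_inv_smul_mem] at hgx
    exact hg (inv_eq_one.1 (Subtype.ext (h hx _ (g⁻¹).2 hgx)))

theorem isFundamentalDomain_square_squareGroup : IsFundamentalDomain squareGroup square :=
  isFundamentalDomain_of_forall_ae measurableSet_square.nullMeasurableSet
    (.of_forall exists_mem_squareGroup_apply_mem_square) <| ae_forall_not_onEdge.mono
      fun _ h hx _ => eq_one_of_mem_squareGroup fun i => mem_Ioo_of_not_onEdge hx (h i)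

theorem isFundamentalDomain_square_pillowGroup : IsFundamentalDomain pillowGroup square :=
  isFundamentalDomain_of_forall_ae measurableSet_square.nullMeasurableSet
    (.of_forall exists_mem_pillowGroup_apply_mem_square) <| ae_forall_not_onEdge.mono
      fun _ h hx _ => eq_one_of_mem_pillowGroup fun i => mem_Ioo_of_not_onEdge hx (h i)

/-! ### The orbifold `ℤ² ⋊ V₄ \ ℝ²` -/

theorem dist_le_dist_of_mem_squareGroup {x y : Plane} (hx : x ∈ square) (hy : y ∈ square)
    {g : Motion} (hg : g ∈ squareGroup) : dist x y ≤ dist x (g y) := by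
  obtain ⟨ε, n, h⟩ := mem_squareGroup.1 hg
  rw [EuclideanSpace.dist_eq, EuclideanSpace.dist_eq]
  gcongr with i
  rw [h, Real.dist_eq, Real.dist_eq]
  exact abs_sub_le_abs_sub_mul_add_int (hx i) (hy i) (ε i) (n i)

theorem isHomeomorph_proj_square : IsHomeomorph fun x : square => proj squareGroup x := by
  have : CompactSpace square := isCompact_iff_compactSpace.1 isCompact_square
  have : ProperlyDiscontinuousSMul squareGroup Plane := properlyDiscontinuousSMul_latticeSemidirect
  rw [isHomeomorph_iff_continuous_bijective]
  refine ⟨(continuous_proj _).comp continuous_subtype_val, ?_, ?_⟩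
  · rintro ⟨x, hx⟩ ⟨y, hy⟩ h
    obtain ⟨g, hg, hgy⟩ := proj_eq_iff.1 h
    have hd := dist_le_dist_of_mem_squareGroup hx hy hg
    rw [hgy, dist_self] at hd
    exact Subtype.ext (dist_le_zero.1 hd)
  · intro q
    obtain ⟨x, rfl⟩ := Quotient.exists_rep q
    obtain ⟨g, hg, hgx⟩ := exists_mem_squareGroup_apply_mem_square x
    exact ⟨⟨g x, hgx⟩, proj_eq_iff.2 ⟨g, hg, rfl⟩⟩

theorem mem_isotropy_squareGroup {x : Plane} (hx : x ∈ square) {γ : Orth} :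
    γ ∈ isotropy squareGroup x ↔
      ∃ ε : Fin 2 → ℤˣ, (∀ i, ε i = 1 ∨ OnEdge i x) ∧ signChange ε = γ := by
  have hfix (ε : Fin 2 → ℤˣ) :
      x - signChange ε x ∈ intLattice ↔ ∀ i, ε i = 1 ∨ OnEdge i x := by
    refine forall_congr' fun i => ?_
    rw [PiLp.sub_apply, signChange_apply, exists_sub_unit_mul_eq_int_iff,
      exists_two_mul_eq_int_iff_eq_zero_or (hx i)]
    simp [OnEdge, hx]
  rw [squareGroup, mem_isotropy_latticeSemidirect, kleinGroup_eq_range_signChange]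
  constructor
  · rintro ⟨⟨ε, rfl⟩, h⟩
    exact ⟨ε, (hfix ε).1 h, rfl⟩
  · rintro ⟨ε, h, rfl⟩
    exact ⟨⟨ε, rfl⟩, (hfix ε).2 h⟩

theorem not_isSingular_squareGroup {x : Plane} (hx : x ∈ square) (h : ∀ i, ¬OnEdge i x) :
    ¬IsSingular squareGroup x := by
  rw [IsSingular, not_not, Subgroup.eq_bot_iff_forall]
  intro γ hγ
  obtain ⟨ε, hε, rfl⟩ := (mem_isotropy_squareGroup hx).1 hγ
  rw [show ε = 1 from funext fun i => (hε i).resolve_right (h i), map_one]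

theorem isotropy_squareGroup_eq_zpowers {x : Plane} (hx : x ∈ square) {i : Fin 2}
    (hi : OnEdge i x) (huniq : ∀ j, OnEdge j x → j = i) :
    isotropy squareGroup x = Subgroup.zpowers (signChange (Function.update 1 i (-1))) := by
  have hupdate : ∀ (i : Fin 2) (ε : Fin 2 → ℤˣ), (∀ j, ε j = 1 ∨ j = i) →
      ε = (1 : Fin 2 → ℤˣ) ∨ ε = Function.update (1 : Fin 2 → ℤˣ) i (-1) := by decide
  apply le_antisymm
  · intro γ hγ
    obtain ⟨ε, hε, rfl⟩ := (mem_isotropy_squareGroup hx).1 hγ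
    rcases hupdate i ε fun j => (hε j).imp_right (huniq j) with rfl | rfl
    · rw [map_one]
      exact one_mem _
    · exact Subgroup.mem_zpowers _
  · rw [Subgroup.zpowers_le, mem_isotropy_squareGroup hx]
    refine ⟨_, fun j => ?_, rfl⟩
    by_cases hj : j = i
    · exact Or.inr (hj ▸ hi)
    · exact Or.inl (Function.update_of_ne hj _ _)

theorem lineReflection_zero : lineReflection 0 = (Submodule.span ℝ {frame 0}).reflection := by
  have h : (!₂[Real.cos 0, Real.sin 0] : Plane) = frame 0 := by
    ext i; fin_cases i <;> simp [frame]
  simp only [lineReflection, h]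

theorem lineReflection_pi_div_two :
    lineReflection (Real.pi / 2) = (Submodule.span ℝ {frame 1}).reflection := by
  have h : (!₂[Real.cos (Real.pi / 2), Real.sin (Real.pi / 2)] : Plane) = frame 1 := by
    ext i; fin_cases i <;> simp [frame]
  simp only [lineReflection, h]

theorem isReflectorPoint_squareGroup {x : Plane} (hx : x ∈ square) (h : ∃! i, OnEdge i x) :
    IsReflectorPoint squareGroup x := by
  obtain ⟨i, hi, huniq⟩ := h
  have hrefl : lineReflection 0 = signChange (Function.update 1 1 (-1)) := by
    rw [lineReflection_zero, reflection_span_frame]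
    congr 1
    decide
  have hconj : MulAut.conj quarterTurn (lineReflection 0) =
      signChange (Function.update 1 0 (-1)) := by
    rw [hrefl, MulAut.conj_apply, mul_inv_eq_iff_eq_mul]
    ext y j
    fin_cases j <;> simp
  have hiso := isotropy_squareGroup_eq_zpowers hx hi huniq
  fin_cases i
  · refine ⟨quarterTurn, ?_⟩
    rw [MonoidHom.map_zpowers]
    exact hiso.trans (congrArg _ hconj.symm)
  · rw [IsReflectorPoint, hrefl]
    exact hiso ▸ hasIsotropyType_isotropy squareGroup x

theorem isDihedralPoint_squareGroup {x : Plane} (hx : x ∈ square) (h : ∀ i, OnEdge i x) :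
    IsDihedralPoint squareGroup 2 x := by
  have hiso : isotropy squareGroup x = kleinGroup := by
    ext γ
    rw [mem_isotropy_squareGroup hx, kleinGroup_eq_range_signChange]
    simp [h, MonoidHom.mem_range]
  refine ⟨le_rfl, ?_⟩
  rw [Nat.cast_ofNat, lineReflection_zero, lineReflection_pi_div_two]
  have htype := hasIsotropyType_isotropy squareGroup x
  rwa [hiso] at htype

/-! ### The orbifold `ℤ² ⋊ C₄ \ ℝ²` -/

/-- The function `t ↦ cos (2πt)` on the circle `ℝ / ℤ`. -/
def cosTwoPi (t : ℝ) : ℝ := Real.cos (2 * Real.pi * t)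

/-- The function `t ↦ sin (2πt)` on the circle `ℝ / ℤ`. -/
def sinTwoPi (t : ℝ) : ℝ := Real.sin (2 * Real.pi * t)

@[fun_prop]
theorem continuous_cosTwoPi : Continuous cosTwoPi := by unfold cosTwoPi; fun_prop

@[fun_prop]
theorem continuous_sinTwoPi : Continuous sinTwoPi := by unfold sinTwoPi; fun_prop

theorem abs_cosTwoPi_le_one (t : ℝ) : |cosTwoPi t| ≤ 1 := Real.abs_cos_le_one _

theorem cosTwoPi_unit_mul_add_int (ε : ℤˣ) (t : ℝ) (n : ℤ) :
    cosTwoPi (ε * t + n) = cosTwoPi t := by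
  rw [cosTwoPi, mul_add, mul_comm _ (n : ℝ), Real.cos_add_int_mul_two_pi, cosTwoPi]
  rcases Int.units_eq_one_or ε with rfl | rfl <;> simp

theorem sinTwoPi_unit_mul_add_int (ε : ℤˣ) (t : ℝ) (n : ℤ) :
    sinTwoPi (ε * t + n) = ε * sinTwoPi t := by
  rw [sinTwoPi, mul_add, mul_comm _ (n : ℝ), Real.sin_add_int_mul_two_pi, sinTwoPi]
  rcases Int.units_eq_one_or ε with rfl | rfl <;> simp

theorem cosTwoPi_neg (t : ℝ) : cosTwoPi (-t) = cosTwoPi t := by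
  simpa using cosTwoPi_unit_mul_add_int (-1) t 0

theorem cosTwoPi_eq_iff {s t : ℝ} :
    cosTwoPi s = cosTwoPi t ↔ ∃ (ε : ℤˣ) (n : ℤ), s = ε * t + n := by
  refine ⟨fun h => ?_, ?_⟩
  · have hpi : 2 * Real.pi ≠ 0 := by positivity
    obtain ⟨n, hn | hn⟩ := Real.cos_eq_cos_iff.1 h.symm
    · exact ⟨1, n, mul_left_cancel₀ hpi (by rw [hn]; push_cast; ring)⟩
    · exact ⟨-1, n, mul_left_cancel₀ hpi (by rw [hn]; push_cast; ring)⟩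
  · rintro ⟨ε, n, rfl⟩
    exact cosTwoPi_unit_mul_add_int ε t n

theorem sinTwoPi_eq_zero_iff {t : ℝ} : sinTwoPi t = 0 ↔ ∃ n : ℤ, 2 * t = n := by
  rw [sinTwoPi, Real.sin_eq_zero_iff]
  refine exists_congr fun n => ?_
  rw [show 2 * Real.pi * t = 2 * t * Real.pi by ring, mul_left_inj' Real.pi_ne_zero, eq_comm]

theorem sinTwoPi_eq_zero_iff_cosTwoPi {t : ℝ} :
    sinTwoPi t = 0 ↔ cosTwoPi t = 1 ∨ cosTwoPi t = -1 :=
  Real.sin_eq_zero_iff_cos_eq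

/-- The height over the point `(u, v)` of the triangle `-1 ≤ v ≤ u ≤ 1` of the convex body whose
boundary is a model of the pillow. -/
def pillowHeight (u v : ℝ) : ℝ := min (min (1 - u) (1 + v)) (u - v)

/-- A function on the plane that is invariant under `ℤ² ⋊ C₄` and changes sign under the
reflections that preserve the integer lattice. -/
def orientationSign (x : Plane) : ℝ :=
  sinTwoPi (x 0) * sinTwoPi (x 1) * (cosTwoPi (x 0) - cosTwoPi (x 1))

/-- The larger of the two numbers `cos (2π xᵢ)`. -/
def maxCos (x : Plane) : ℝ := max (cosTwoPi (x 0)) (cosTwoPi (x 1))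

/-- The smaller of the two numbers `cos (2π xᵢ)`. -/
def minCos (x : Plane) : ℝ := min (cosTwoPi (x 0)) (cosTwoPi (x 1))

/-- The height of the pillow, with the sign that tells its upper from its lower side. -/
def signedHeight (x : Plane) : ℝ :=
  SignType.sign (orientationSign x) * pillowHeight (maxCos x) (minCos x)

/-- The `ℤ² ⋊ C₄`-invariant map from the plane onto the boundary of a convex body that identifies
the quotient with a sphere. -/
def pillowMap (x : Plane) : EuclideanSpace ℝ (Fin 3) := !₂[maxCos x, minCos x, signedHeight x]

theorem pillowHeight_nonneg (x : Plane) : 0 ≤ pillowHeight (maxCos x) (minCos x) := by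
  have h (i : Fin 2) := abs_le.1 (abs_cosTwoPi_le_one (x i))
  exact le_min (le_min (sub_nonneg.2 (max_le (h 0).2 (h 1).2))
    (neg_le_iff_add_nonneg'.1 (le_min (h 0).1 (h 1).1))) (sub_nonneg.2 min_le_max)

theorem pillowHeight_eq_zero_iff (x : Plane) :
    pillowHeight (maxCos x) (minCos x) = 0 ↔ orientationSign x = 0 := by
  have h (i : Fin 2) := abs_le.1 (abs_cosTwoPi_le_one (x i))
  rw [orientationSign, mul_eq_zero, mul_eq_zero, sinTwoPi_eq_zero_iff_cosTwoPi,
    sinTwoPi_eq_zero_iff_cosTwoPi, pillowHeight, maxCos, minCos]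
  grind

theorem abs_signedHeight (x : Plane) : |signedHeight x| = pillowHeight (maxCos x) (minCos x) := by
  have h := (pillowHeight_eq_zero_iff x).2
  rw [signedHeight, abs_mul, abs_of_nonneg (pillowHeight_nonneg x)]
  rcases lt_trichotomy (orientationSign x) 0 with hx | hx | hx <;> simp [hx, h]

theorem signedHeight_eq_zero_iff (x : Plane) : signedHeight x = 0 ↔ orientationSign x = 0 := by
  rw [← abs_eq_zero, abs_signedHeight, pillowHeight_eq_zero_iff]

theorem continuous_sign_mul {X : Type*} [TopologicalSpace X] {f h : X → ℝ} (hf : Continuous f)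
    (hh : Continuous h) (hzero : ∀ x, f x = 0 → h x = 0) :
    Continuous fun x => (SignType.sign (f x) : ℝ) * h x := by
  have heq : (fun x => (SignType.sign (f x) : ℝ) * h x) =
      fun x => if 0 ≤ f x then h x else -h x := by
    funext x
    rcases lt_trichotomy (f x) 0 with hx | hx | hx
    · simp [hx, hx.not_ge]
    · simp [hx, hzero]
    · simp [hx, hx.le]
  rw [heq]
  exact hh.if_le hh.neg continuous_const hf fun x hx => by simp [hzero x hx.symm]

theorem continuous_pillowMap : Continuous pillowMap := by
  have hmax : Continuous maxCos := by unfold maxCos; fun_prop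
  have hmin : Continuous minCos := by unfold minCos; fun_prop
  have hsign : Continuous orientationSign := by unfold orientationSign; fun_prop
  have hheight : Continuous fun x => pillowHeight (maxCos x) (minCos x) := by
    unfold pillowHeight; fun_prop
  have hsigned : Continuous signedHeight :=
    continuous_sign_mul hsign hheight fun x => (pillowHeight_eq_zero_iff x).2
  refine (PiLp.continuous_toLp 2 _).comp (continuous_pi fun i => ?_)
  fin_cases i <;> assumption

theorem pillowMap_eq_iff {x : Plane} {p : EuclideanSpace ℝ (Fin 3)} : pillowMap x = p ↔
    maxCos x = p 0 ∧ minCos x = p 1 ∧ signedHeight x = p 2 := by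
  simp [PiLp.ext_iff, Fin.forall_fin_succ, pillowMap]

theorem pillowMap_apply_of_mem {g : Motion} (hg : g ∈ pillowGroup) (x : Plane) :
    pillowMap (g x) = pillowMap x := by
  suffices h : maxCos (g x) = maxCos x ∧ minCos (g x) = minCos x ∧
      orientationSign (g x) = orientationSign x by
    rw [pillowMap, signedHeight, h.1, h.2.1, h.2.2, pillowMap, signedHeight]
  obtain ⟨ε, n, h | h⟩ := mem_pillowGroup.1 hg
  · simp only [maxCos, minCos, orientationSign, h, cosTwoPi_unit_mul_add_int,
      sinTwoPi_unit_mul_add_int]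
    rcases Int.units_eq_one_or ε with rfl | rfl <;> simp
  · simp only [maxCos, minCos, orientationSign, h, cosTwoPi_unit_mul_add_int,
      sinTwoPi_unit_mul_add_int, quarterTurn_apply_zero, quarterTurn_apply_one, cosTwoPi_neg]
    have hneg : sinTwoPi (-x 1) = -sinTwoPi (x 1) := by
      simpa using sinTwoPi_unit_mul_add_int (-1) (x 1) 0
    refine ⟨max_comm _ _, min_comm _ _, ?_⟩
    rw [hneg]
    rcases Int.units_eq_one_or ε with rfl | rfl <;> push_cast <;> ring

theorem exists_eq_neg_unit_mul_add_int {s t : ℝ} {ε : ℤˣ} {n : ℤ} (h : s = ε * t + n)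
    (ht : sinTwoPi t = 0) : ∃ m : ℤ, s = (-ε : ℤˣ) * t + m := by
  obtain ⟨k, hk⟩ := sinTwoPi_eq_zero_iff.1 ht
  refine ⟨n + ε * k, ?_⟩
  push_cast
  rw [h, ← hk]
  ring

theorem proj_pillowGroup_eq_of_unit {x y : Plane} {ε : ℤˣ} {m n : ℤ} (h0 : x 0 = ε * y 0 + m)
    (h1 : x 1 = ε * y 1 + n) : proj pillowGroup x = proj pillowGroup y := by
  refine proj_eq_iff.2 ⟨motionOf (signChange fun _ => ε) !₂[(m : ℝ), (n : ℝ)],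
    mem_pillowGroup.2 ⟨ε, ![m, n], Or.inl fun z i => ?_⟩, ?_⟩
  · fin_cases i <;> simp
  · ext i
    fin_cases i <;> simp [h0, h1]

theorem proj_pillowGroup_quarterTurn (y : Plane) :
    proj pillowGroup (quarterTurn y) = proj pillowGroup y :=
  proj_eq_iff.2 ⟨motionOf quarterTurn 0, mem_pillowGroup.2 ⟨1, 0, Or.inr (by simp)⟩, by simp⟩

theorem proj_eq_of_pillowMap_eq_of_cos {x y : Plane} (h : pillowMap x = pillowMap y)
    (hcos : ∀ i, cosTwoPi (x i) = cosTwoPi (y i)) :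
    proj pillowGroup x = proj pillowGroup y := by
  choose ε n hx using fun i => cosTwoPi_eq_iff.1 (hcos i)
  by_cases hε : ε 0 = ε 1
  · exact proj_pillowGroup_eq_of_unit (hx 0) (hε ▸ hx 1)
  have hε : ε 1 = -ε 0 := Int.units_ne_iff_eq_neg.1 (Ne.symm hε)
  have hsign : orientationSign x = -orientationSign y := by
    simp only [orientationSign, hx, cosTwoPi_unit_mul_add_int, sinTwoPi_unit_mul_add_int, hε]
    rcases Int.units_eq_one_or (ε 0) with h0 | h0 <;> rw [h0] <;> push_cast <;> ring
  obtain ⟨hmax, hmin, hheight⟩ := pillowMap_eq_iff.1 h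
  have hzero : orientationSign y = 0 := by
    rw [← signedHeight_eq_zero_iff, ← self_eq_neg]
    refine hheight.symm.trans ?_
    rw [signedHeight, hsign, show maxCos x = maxCos y from hmax,
      show minCos x = minCos y from hmin, signedHeight, Left.sign_neg]
    simp
  rw [orientationSign, mul_eq_zero, mul_eq_zero, sub_eq_zero] at hzero
  rcases hzero with (hsin | hsin) | hcos
  · obtain ⟨m, h0⟩ := exists_eq_neg_unit_mul_add_int (hx 0) hsin
    exact proj_pillowGroup_eq_of_unit h0 (hε ▸ hx 1)
  · obtain ⟨m, h1⟩ := exists_eq_neg_unit_mul_add_int (hx 1) hsin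
    rw [hε, neg_neg] at h1
    exact proj_pillowGroup_eq_of_unit (hx 0) h1
  · obtain ⟨η, k, hk⟩ := cosTwoPi_eq_iff.1 hcos
    rw [← proj_pillowGroup_quarterTurn y]
    refine proj_pillowGroup_eq_of_unit (ε := -(ε 0 * η)) (m := ε 0 * k + n 0)
      (n := ε 0 * η * k + n 1) ?_ ?_
    · rw [hx 0, hk, quarterTurn_apply_zero]
      push_cast
      ring
    · rw [hx 1, hε, quarterTurn_apply_one, hk]
      rcases Int.units_eq_one_or η with rfl | rfl <;> push_cast <;> ring

theorem proj_pillowGroup_eq_iff {x y : Plane} :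
    proj pillowGroup x = proj pillowGroup y ↔ pillowMap x = pillowMap y := by
  refine ⟨fun h => ?_, fun h => ?_⟩
  · obtain ⟨g, hg, rfl⟩ := proj_eq_iff.1 h
    exact pillowMap_apply_of_mem hg y
  · have hcos : (∀ i, cosTwoPi (x i) = cosTwoPi (y i)) ∨
        ∀ i, cosTwoPi (x i) = cosTwoPi (quarterTurn y i) := by
      obtain ⟨hmax, hmin, -⟩ := pillowMap_eq_iff.1 h
      have hmax : maxCos x = maxCos y := hmax
      have hmin : minCos x = minCos y := hmin
      simp only [Fin.forall_fin_two, quarterTurn_apply_zero, quarterTurn_apply_one, cosTwoPi_neg]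
      unfold maxCos minCos at *
      grind
    rcases hcos with hcos | hcos
    · exact proj_eq_of_pillowMap_eq_of_cos h hcos
    · have hturn := proj_pillowGroup_quarterTurn y
      obtain ⟨g, hg, hgy⟩ := proj_eq_iff.1 hturn
      rw [← hturn]
      exact proj_eq_of_pillowMap_eq_of_cos (hgy ▸ h.trans (pillowMap_apply_of_mem hg y).symm) hcos

/-- The convex body whose boundary is the image of `pillowMap`. -/
def pillowBody : Set (EuclideanSpace ℝ (Fin 3)) := {p | |p 2| ≤ pillowHeight (p 0) (p 1)}

theorem mem_pillowBody {p : EuclideanSpace ℝ (Fin 3)} :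
    p ∈ pillowBody ↔ (|p 2| ≤ 1 - p 0 ∧ |p 2| ≤ 1 + p 1) ∧ |p 2| ≤ p 0 - p 1 := by
  change |p 2| ≤ min (min (1 - p 0) (1 + p 1)) (p 0 - p 1) ↔ _
  rw [le_min_iff, le_min_iff]

theorem convex_pillowBody : Convex ℝ pillowBody := by
  intro p hp q hq a b ha hb hab
  obtain rfl : b = 1 - a := by linarith
  have habs : |(a • p + (1 - a) • q) 2| ≤ a * |p 2| + (1 - a) * |q 2| := by
    refine (abs_add_le (a * p 2) ((1 - a) * q 2)).trans ?_
    rw [abs_mul, abs_mul, abs_of_nonneg ha, abs_of_nonneg hb]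
  rw [mem_pillowBody] at hp hq ⊢
  simp only [PiLp.add_apply, PiLp.smul_apply, smul_eq_mul] at habs ⊢
  refine ⟨⟨?_, ?_⟩, ?_⟩
  · linarith [mul_le_mul_of_nonneg_left hp.1.1 ha, mul_le_mul_of_nonneg_left hq.1.1 hb]
  · linarith [mul_le_mul_of_nonneg_left hp.1.2 ha, mul_le_mul_of_nonneg_left hq.1.2 hb]
  · linarith [mul_le_mul_of_nonneg_left hp.2 ha, mul_le_mul_of_nonneg_left hq.2 hb]

theorem continuous_pillowHeight :
    Continuous fun p : EuclideanSpace ℝ (Fin 3) => pillowHeight (p 0) (p 1) := by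
  unfold pillowHeight
  fun_prop

theorem nonempty_interior_pillowBody : (interior pillowBody).Nonempty := by
  have hopen : IsOpen {p : EuclideanSpace ℝ (Fin 3) | |p 2| < pillowHeight (p 0) (p 1)} :=
    isOpen_lt (by fun_prop) continuous_pillowHeight
  refine ⟨!₂[1 / 2, -1 / 2, 0], interior_maximal (fun _ hp => ?_) hopen ?_⟩
  · exact (Set.mem_ofPred.1 hp).le
  · change |(0 : ℝ)| < pillowHeight (1 / 2) (-1 / 2)
    norm_num [pillowHeight]

theorem isBounded_pillowBody : Bornology.IsBounded pillowBody := by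
  refine isBounded_iff_forall_norm_le.2 ⟨√(1 ^ 2 + 1 ^ 2 + 2 ^ 2), fun p hp => ?_⟩
  rw [mem_pillowBody] at hp
  have h := abs_nonneg (p 2)
  rw [EuclideanSpace.norm_eq, Fin.sum_univ_three]
  simp only [Real.norm_eq_abs]
  gcongr
  · exact abs_le.2 ⟨by linarith, by linarith⟩
  · exact abs_le.2 ⟨by linarith, by linarith⟩
  · linarith

theorem frontier_pillowBody : frontier pillowBody = {p | |p 2| = pillowHeight (p 0) (p 1)} := by
  refine Set.Subset.antisymm
    (frontier_le_subset_eq (by fun_prop) continuous_pillowHeight) fun p hp => ?_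
  have hp : |p 2| = pillowHeight (p 0) (p 1) := hp
  refine ⟨subset_closure hp.le, fun hint => ?_⟩
  let q (t : ℝ) : EuclideanSpace ℝ (Fin 3) := !₂[p 0, p 1, p 2 + t]
  have hq : Continuous q := (PiLp.continuous_toLp 2 _).comp (continuous_pi
    (Fin.forall_fin_succ.2 ⟨continuous_const, Fin.forall_fin_two.2
      ⟨continuous_const, continuous_const.add continuous_id⟩⟩))
  have hq0 : q 0 = p := by ext i; fin_cases i <;> simp [q]
  have hmem : ∀ᶠ t : ℝ in nhds 0, |p 2 + t| ≤ |p 2| := by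
    rw [hp]
    exact hq.continuousAt.preimage_mem_nhds (hq0 ▸ mem_interior_iff_mem_nhds.1 hint)
  have hneg : ∀ᶠ t : ℝ in nhds 0, |p 2 + -t| ≤ |p 2| :=
    (neg_zero (G := ℝ) ▸ continuous_neg.tendsto (0 : ℝ)).eventually hmem
  obtain ⟨t, ⟨hle, hle'⟩, ht⟩ := (((hmem.and hneg).filter_mono nhdsWithin_le_nhds).and
    (self_mem_nhdsWithin (s := Set.Ioi (0 : ℝ)))).exists
  rcases abs_cases (p 2) with h | h <;>
    linarith [ht, le_abs_self (p 2 + t), neg_le_abs (p 2 + -t)]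

theorem pillowMap_mem_frontier (x : Plane) : pillowMap x ∈ frontier pillowBody := by
  rw [frontier_pillowBody]
  exact abs_signedHeight x

theorem signedHeight_nonneg {x : Plane} (hx : 0 ≤ orientationSign x) : 0 ≤ signedHeight x :=
  mul_nonneg (by rcases hx.eq_or_lt' with h | h <;> simp [h]) (pillowHeight_nonneg x)

theorem pillowMap_swap (x : Plane) :
    pillowMap !₂[x 1, x 0] = !₂[maxCos x, minCos x, -signedHeight x] := by
  have hmax : maxCos !₂[x 1, x 0] = maxCos x := max_comm _ _
  have hmin : minCos !₂[x 1, x 0] = minCos x := min_comm _ _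
  have hsign : orientationSign !₂[x 1, x 0] = -orientationSign x := by
    simp only [orientationSign, Matrix.cons_val_zero, Matrix.cons_val_one]
    ring
  rw [pillowMap, signedHeight, hmax, hmin, hsign, Left.sign_neg, signedHeight]
  simp

theorem exists_cosTwoPi_eq {u : ℝ} (hu : |u| ≤ 1) : ∃ t, cosTwoPi t = u ∧ 0 ≤ sinTwoPi t := by
  refine ⟨Real.arccos u / (2 * Real.pi), ?_⟩
  rw [cosTwoPi, sinTwoPi, mul_div_cancel₀ _ (by positivity), Real.sin_arccos,
    Real.cos_arccos (abs_le.1 hu).1 (abs_le.1 hu).2]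
  exact ⟨rfl, Real.sqrt_nonneg _⟩

theorem exists_maxCos_minCos_eq {u v : ℝ} (hu : |u| ≤ 1) (hv : |v| ≤ 1) (hvu : v ≤ u) :
    ∃ x, maxCos x = u ∧ minCos x = v ∧ 0 ≤ signedHeight x := by
  obtain ⟨s, hs, hs'⟩ := exists_cosTwoPi_eq hu
  obtain ⟨t, ht, ht'⟩ := exists_cosTwoPi_eq hv
  refine ⟨!₂[s, t], ?_, ?_, signedHeight_nonneg ?_⟩
  · simp [maxCos, hs, ht, hvu]
  · simp [minCos, hs, ht, hvu]
  · simpa [orientationSign, hs, ht] using mul_nonneg (mul_nonneg hs' ht') (sub_nonneg.2 hvu)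

theorem exists_pillowMap_eq {p : EuclideanSpace ℝ (Fin 3)} (hp : p ∈ frontier pillowBody) :
    ∃ x, pillowMap x = p := by
  rw [frontier_pillowBody] at hp
  have hp : |p 2| = pillowHeight (p 0) (p 1) := hp
  obtain ⟨⟨h0, h1⟩, h2⟩ := mem_pillowBody.1 (show p ∈ pillowBody from hp.le)
  have hpos := abs_nonneg (p 2)
  obtain ⟨x, hmax, hmin, hnonneg⟩ := exists_maxCos_minCos_eq (u := p 0) (v := p 1)
    (abs_le.2 ⟨by linarith, by linarith⟩) (abs_le.2 ⟨by linarith, by linarith⟩) (by linarith)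
  have hheight : signedHeight x = |p 2| := by
    rw [hp, ← abs_of_nonneg hnonneg, abs_signedHeight, hmax, hmin]
  rcases abs_choice (p 2) with habs | habs
  · exact ⟨x, pillowMap_eq_iff.2 ⟨hmax, hmin, hheight.trans habs⟩⟩
  · refine ⟨!₂[x 1, x 0], ?_⟩
    rw [pillowMap_swap, hmax, hmin, hheight, habs, neg_neg]
    ext i
    fin_cases i <;> rfl

theorem nonempty_homeomorph_frontier_pillowBody :
    Nonempty (Underlying pillowGroup ≃ₜ frontier pillowBody) := by
  have := compactSpace_underlying isCompact_square exists_mem_pillowGroup_apply_mem_square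
  let f : Underlying pillowGroup → frontier pillowBody :=
    Quotient.lift (fun x => ⟨pillowMap x, pillowMap_mem_frontier x⟩) fun _ _ h =>
      Subtype.ext (proj_pillowGroup_eq_iff.1 (Quotient.sound h))
  have hf : Continuous f := (continuous_pillowMap.subtype_mk _).quotient_lift _
  have hinj : Function.Injective f := by
    rintro ⟨x⟩ ⟨y⟩ h
    exact proj_pillowGroup_eq_iff.2 (congrArg Subtype.val h)
  have hsurj : Function.Surjective f := by
    rintro ⟨p, hp⟩
    obtain ⟨x, rfl⟩ := exists_pillowMap_eq hp
    exact ⟨proj pillowGroup x, rfl⟩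
  exact ⟨(isHomeomorph_iff_continuous_bijective.2 ⟨hf, hinj, hsurj⟩).homeomorph⟩

theorem nonempty_homeomorph_sphere :
    Nonempty (Underlying pillowGroup ≃ₜ Metric.sphere (0 : EuclideanSpace ℝ (Fin 3)) 1) := by
  obtain ⟨e⟩ := nonempty_homeomorph_frontier_pillowBody
  obtain ⟨h, -, -, hfrontier⟩ := exists_homeomorph_image_interior_closure_frontier_eq_unitBall
    convex_pillowBody nonempty_interior_pillowBody isBounded_pillowBody
  exact ⟨e.trans ((h.image _).trans (Homeomorph.setCongr hfrontier))⟩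

theorem isSingular_pillowGroup_iff_signChange {x : Plane} :
    IsSingular pillowGroup x ↔ signChange (-1) ∈ isotropy pillowGroup x := by
  rw [IsSingular, Subgroup.ne_bot_iff_exists_ne_one]
  refine ⟨?_, fun h => ⟨⟨_, h⟩, fun h1 => signChange_neg_one_ne_one (congrArg Subtype.val h1)⟩⟩
  rintro ⟨⟨γ, hγ⟩, hne⟩
  have hne : γ ≠ 1 := fun h => hne (Subtype.ext h)
  obtain ⟨ε, rfl | rfl⟩ := mem_rotGroup.1 (mem_isotropy_latticeSemidirect.1 hγ).1
  · rcases Int.units_eq_one_or ε with rfl | rfl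
    · exact absurd (map_one signChange) hne
    · exact hγ
  · have hsq : signChange (fun _ => ε) * quarterTurn * (signChange (fun _ => ε) * quarterTurn) =
        signChange (-1) := by
      rw [← quarterTurn_mul_self]
      ext y i
      rcases Int.units_eq_one_or ε with rfl | rfl <;> fin_cases i <;> simp
    exact hsq ▸ mul_mem hγ hγ

theorem isSingular_pillowGroup_iff_sinTwoPi {x : Plane} :
    IsSingular pillowGroup x ↔ ∀ i, sinTwoPi (x i) = 0 := by
  have hmem : signChange (-1) ∈ rotGroup := mem_rotGroup.2 ⟨-1, Or.inl rfl⟩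
  rw [isSingular_pillowGroup_iff_signChange, pillowGroup, mem_isotropy_latticeSemidirect,
    and_iff_right hmem]
  refine forall_congr' fun i => ?_
  rw [PiLp.sub_apply, signChange_apply, exists_sub_unit_mul_eq_int_iff, sinTwoPi_eq_zero_iff,
    or_iff_right (by simp)]

theorem pillowMap_eq_iff_of_orientationSign {x : Plane} (hx : orientationSign x = 0) {u v : ℝ} :
    pillowMap x = !₂[u, v, 0] ↔ maxCos x = u ∧ minCos x = v := by
  simp [pillowMap_eq_iff, (signedHeight_eq_zero_iff x).2 hx]

theorem cosTwoPi_zero : cosTwoPi 0 = 1 := by simp [cosTwoPi]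

theorem cosTwoPi_inv_two : cosTwoPi 2⁻¹ = -1 := by
  rw [cosTwoPi, ← div_eq_mul_inv, mul_div_cancel_left₀ _ two_ne_zero, Real.cos_pi]

theorem pillowMap_origin : pillowMap !₂[0, 0] = !₂[1, 1, 0] := by
  rw [pillowMap_eq_iff_of_orientationSign (by simp [orientationSign])]
  simp [maxCos, minCos, cosTwoPi_zero]

theorem pillowMap_center : pillowMap !₂[1 / 2, 1 / 2] = !₂[-1, -1, 0] := by
  rw [pillowMap_eq_iff_of_orientationSign (by simp [orientationSign])]
  simp [maxCos, minCos, cosTwoPi_inv_two]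

theorem sinTwoPi_zero : sinTwoPi 0 = 0 := by simp [sinTwoPi]

theorem pillowMap_edge : pillowMap !₂[1 / 2, 0] = !₂[1, -1, 0] := by
  rw [pillowMap_eq_iff_of_orientationSign (by simp [orientationSign, sinTwoPi_zero])]
  simp [maxCos, minCos, cosTwoPi_inv_two, cosTwoPi_zero]

theorem proj_edge_eq : proj pillowGroup !₂[1 / 2, 0] = proj pillowGroup !₂[0, 1 / 2] := by
  rw [proj_pillowGroup_eq_iff, pillowMap_edge, eq_comm,
    pillowMap_eq_iff_of_orientationSign (by simp [orientationSign, sinTwoPi_zero])]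
  simp [maxCos, minCos, cosTwoPi_inv_two, cosTwoPi_zero]

theorem isSingular_pillowGroup_iff {x : Plane} : IsSingular pillowGroup x ↔
    proj pillowGroup x = proj pillowGroup !₂[0, 0] ∨
    proj pillowGroup x = proj pillowGroup !₂[1 / 2, 1 / 2] ∨
    proj pillowGroup x = proj pillowGroup !₂[1 / 2, 0] := by
  simp only [isSingular_pillowGroup_iff_sinTwoPi, proj_pillowGroup_eq_iff, pillowMap_origin,
    pillowMap_center, pillowMap_edge, sinTwoPi_eq_zero_iff_cosTwoPi, Fin.forall_fin_two]
  constructor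
  · intro h
    have hx : orientationSign x = 0 := by
      simp [orientationSign, sinTwoPi_eq_zero_iff_cosTwoPi.2 h.1]
    simp only [pillowMap_eq_iff_of_orientationSign hx, maxCos, minCos]
    grind
  · rw [pillowMap_eq_iff, pillowMap_eq_iff, pillowMap_eq_iff]
    simp [maxCos, minCos]
    grind

theorem isConePoint_four_of_quarterTurn_mem {x : Plane} (hx : x - quarterTurn x ∈ intLattice) :
    IsConePoint pillowGroup 4 x := by
  have hiso : isotropy pillowGroup x = rotGroup := by
    refine le_antisymm (fun γ hγ => (mem_isotropy_latticeSemidirect.1 hγ).1) ?_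
    exact Subgroup.zpowers_le.2
      (mem_isotropy_latticeSemidirect.2 ⟨Subgroup.mem_zpowers _, hx⟩)
  have htype := hasIsotropyType_isotropy pillowGroup x
  have hangle : 2 * Real.pi / (4 : ℕ) = Real.pi / 2 := by push_cast; ring
  refine ⟨by norm_num, ?_⟩
  rwa [hangle, ← rotGroup, ← hiso]

theorem rotation_pi : rotation Real.pi = signChange (-1) := by
  ext x i
  fin_cases i <;> simp [rotation]

theorem isotropy_pillowGroup_edge :
    isotropy pillowGroup !₂[1 / 2, 0] = Subgroup.zpowers (signChange (-1)) := by
  have hmem := isSingular_pillowGroup_iff_signChange.1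
    (isSingular_pillowGroup_iff.2 (.inr (.inr rfl)) : IsSingular pillowGroup !₂[1 / 2, 0])
  refine le_antisymm (fun γ hγ => ?_) (Subgroup.zpowers_le.2 hmem)
  obtain ⟨hrot, hint⟩ := mem_isotropy_latticeSemidirect.1 hγ
  obtain ⟨ε, rfl | rfl⟩ := mem_rotGroup.1 hrot
  · rcases Int.units_eq_one_or ε with rfl | rfl
    · exact (map_one (signChange (ι := Fin 2))).symm ▸ one_mem _
    · exact Subgroup.mem_zpowers _
  · obtain ⟨n, hn⟩ := hint 1
    have hodd : -(ε : ℤ) = 2 * n := by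
      have h : -(ε * (2 : ℝ)⁻¹) = n := by simpa using hn
      have h' : -(ε : ℝ) = 2 * n := by linarith
      exact_mod_cast h'
    rcases Int.units_eq_one_or ε with rfl | rfl <;> norm_num at hodd <;> omega

theorem isConePoint_two_edge : IsConePoint pillowGroup 2 !₂[1 / 2, 0] := by
  have htype := hasIsotropyType_isotropy pillowGroup !₂[1 / 2, 0]
  refine ⟨le_rfl, ?_⟩
  rwa [isotropy_pillowGroup_edge, ← rotation_pi,
    ← mul_div_cancel_left₀ Real.pi two_ne_zero] at htype

theorem proj_origin_ne_center : proj pillowGroup !₂[0, 0] ≠ proj pillowGroup !₂[1 / 2, 1 / 2] := by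
  rw [Ne, proj_pillowGroup_eq_iff, pillowMap_origin, pillowMap_center]
  exact fun h => absurd (congrArg (fun p : EuclideanSpace ℝ (Fin 3) => p 0) h) (by norm_num)

theorem proj_origin_ne_edge : proj pillowGroup !₂[0, 0] ≠ proj pillowGroup !₂[1 / 2, 0] := by
  rw [Ne, proj_pillowGroup_eq_iff, pillowMap_origin, pillowMap_edge]
  exact fun h => absurd (congrArg (fun p : EuclideanSpace ℝ (Fin 3) => p 1) h) (by norm_num)

theorem proj_center_ne_edge :
    proj pillowGroup !₂[1 / 2, 1 / 2] ≠ proj pillowGroup !₂[1 / 2, 0] := by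
  rw [Ne, proj_pillowGroup_eq_iff, pillowMap_center, pillowMap_edge]
  exact fun h => absurd (congrArg (fun p : EuclideanSpace ℝ (Fin 3) => p 0) h) (by norm_num)

theorem isConePoint_four_origin : IsConePoint pillowGroup 4 !₂[0, 0] :=
  isConePoint_four_of_quarterTurn_mem (mem_intLattice.2 ⟨0, by simp⟩)

theorem isConePoint_four_center : IsConePoint pillowGroup 4 !₂[1 / 2, 1 / 2] :=
  isConePoint_four_of_quarterTurn_mem
    (mem_intLattice.2 ⟨![1, 0], Fin.forall_fin_two.2 ⟨by norm_num, by simp⟩⟩)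

/-! ### The Hodge Laplacian of the flat plane -/

/-- The contraction `ι_v` as a continuous linear map on alternating forms, so that it can be
differentiated. -/
def contraction (p : ℕ) (v : Plane) : Plane [⋀^Fin (p + 1)]→L[ℝ] ℝ →L[ℝ] Plane [⋀^Fin p]→L[ℝ] ℝ :=
  (ContinuousAlternatingMap.curryLeftLI : _ →ₗᵢ[ℝ]
    Plane →L[ℝ] Plane [⋀^Fin p]→L[ℝ] ℝ).toContinuousLinearMap.flip v

theorem contraction_apply_apply {p : ℕ} (v : Plane) (a : Plane [⋀^Fin (p + 1)]→L[ℝ] ℝ)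
    (w : Fin p → Plane) : contraction p v a w = a (Fin.cons v w) := rfl

theorem hasFDerivAt_fderiv {E : Type*} [NormedAddCommGroup E] [NormedSpace ℝ E] {f : Plane → E}
    {x : Plane} (hf : ContDiffAt ℝ 2 f x) :
    HasFDerivAt (fderiv ℝ f) (fderiv ℝ (fderiv ℝ f) x) x :=
  ((hf.fderiv_right (m := 1) (by norm_num)).differentiableAt one_ne_zero).hasFDerivAt

theorem hasFDerivAt_codiff {p : ℕ} {ω : Form (p + 1)} {x : Plane} (hω : ContDiffAt ℝ 2 ω x) :
    HasFDerivAt (codiff ω)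
      (-∑ i, (contraction p (frame i)).comp ((fderiv ℝ (fderiv ℝ ω) x).flip (frame i))) x := by
  refine (HasFDerivAt.fun_sum fun i _ => ?_).neg
  refine (contraction p (frame i)).hasFDerivAt.comp x
    (((hasFDerivAt_fderiv hω).clm_apply (hasFDerivAt_const (frame i) x)).congr_fderiv ?_)
  ext v
  simp

theorem hasFDerivAt_extDeriv {p : ℕ} {ω : Form p} {x : Plane} (hω : ContDiffAt ℝ 2 ω x) :
    HasFDerivAt (extDeriv ω)
      ((ContinuousAlternatingMap.alternatizeUncurryFinCLM ℝ Plane ℝ).comp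
        (fderiv ℝ (fderiv ℝ ω) x)) x :=
  (ContinuousAlternatingMap.alternatizeUncurryFinCLM ℝ Plane ℝ).hasFDerivAt.comp x
    (hasFDerivAt_fderiv hω)

theorem laplacian_eq_sum_fderiv {E : Type*} [NormedAddCommGroup E] [NormedSpace ℝ E]
    (f : Plane → E) (x : Plane) :
    Δ f x = ∑ i, fderiv ℝ (fderiv ℝ f) x (frame i) (frame i) := by
  rw [InnerProductSpace.laplacian_eq_iteratedFDeriv_orthonormalBasis f
    (EuclideanSpace.basisFun (Fin 2) ℝ)]
  simp [iteratedFDeriv_two_apply, frame]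

theorem extDeriv_codiff_apply {p : ℕ} {ω : Form (p + 1)} {x : Plane} (hω : ContDiffAt ℝ 2 ω x)
    (v : Fin (p + 1) → Plane) :
    extDeriv (codiff ω) x v = -∑ i, ∑ k : Fin (p + 1), (-1) ^ (k : ℕ) *
      fderiv ℝ (fderiv ℝ ω) x (v k) (frame i) (Fin.cons (frame i) (k.removeNth v)) := by
  rw [extDeriv, (hasFDerivAt_codiff hω).fderiv,
    ContinuousAlternatingMap.alternatizeUncurryFin_apply, Finset.sum_comm,
    ← Finset.sum_neg_distrib]
  refine Finset.sum_congr rfl fun k _ => ?_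
  simp [contraction_apply_apply]

theorem codiff_extDeriv_apply {p : ℕ} {ω : Form (p + 1)} {x : Plane} (hω : ContDiffAt ℝ 2 ω x)
    (v : Fin (p + 1) → Plane) :
    codiff (extDeriv ω) x v = -∑ i, (fderiv ℝ (fderiv ℝ ω) x (frame i) (frame i) v -
      ∑ k : Fin (p + 1), (-1) ^ (k : ℕ) *
        fderiv ℝ (fderiv ℝ ω) x (frame i) (v k) (Fin.cons (frame i) (k.removeNth v))) := by
  rw [codiff, (hasFDerivAt_extDeriv hω).fderiv]
  simp only [ContinuousAlternatingMap.neg_apply, ContinuousAlternatingMap.sum_apply]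
  refine congrArg Neg.neg (Finset.sum_congr rfl fun i _ => ?_)
  change ContinuousAlternatingMap.alternatizeUncurryFin _ (Fin.cons (frame i) v) = _
  rw [ContinuousAlternatingMap.alternatizeUncurryFin_apply, Fin.sum_univ_succ, sub_eq_add_neg,
    ← Finset.sum_neg_distrib]
  refine congrArg₂ (· + ·) (by simp) (Finset.sum_congr rfl fun k _ => ?_)
  have hcons : k.succ.removeNth (Fin.cons (frame i) v : Fin (p + 2) → Plane) =
      Fin.cons (frame i) (k.removeNth v) := Fin.cons_comp_succ_succAbove _ _ _
  simp [hcons, pow_succ]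

theorem hodgeLaplacian_eq_neg_laplacian {p : ℕ} {ω : Form (p + 1)} {x : Plane}
    (hω : ContDiffAt ℝ 2 ω x) : hodgeLaplacian ω x = -Δ ω x := by
  have hsymm := hω.isSymmSndFDerivAt (by simp)
  ext v
  change extDeriv (codiff ω) x v + codiff (extDeriv ω) x v = -Δ ω x v
  simp only [extDeriv_codiff_apply hω, codiff_extDeriv_apply hω, laplacian_eq_sum_fderiv,
    hsymm.eq (v _), Finset.sum_sub_distrib, ContinuousAlternatingMap.sum_apply]
  ring

theorem laplacian_comp_linearIsometryEquiv {E : Type*} [NormedAddCommGroup E] [NormedSpace ℝ E]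
    {f : Plane → E} (hf : ContDiff ℝ 2 f) (e : Orth) (x : Plane) :
    Δ (f ∘ e) x = Δ f (e x) := by
  rw [InnerProductSpace.laplacian_eq_iteratedFDeriv_orthonormalBasis (f ∘ e)
    (EuclideanSpace.basisFun (Fin 2) ℝ),
    InnerProductSpace.laplacian_eq_iteratedFDeriv_orthonormalBasis f
    ((EuclideanSpace.basisFun (Fin 2) ℝ).map e)]
  refine Finset.sum_congr rfl fun i _ => ?_
  have hcomp : iteratedFDeriv ℝ 2 (f ∘ e) x =
      (iteratedFDeriv ℝ 2 f (e x)).compContinuousLinearMap fun _ => (e : Plane →L[ℝ] Plane) :=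
    (e : Plane →L[ℝ] Plane).iteratedFDeriv_comp_right hf x le_rfl
  rw [hcomp, ContinuousMultilinearMap.compContinuousLinearMap_apply]
  refine congrArg _ (funext fun k => ?_)
  fin_cases k <;> simp

theorem hasFDerivAt_coord (i : Fin 2) (x : Plane) :
    HasFDerivAt (fun x : Plane => x i) (EuclideanSpace.proj (𝕜 := ℝ) i) x :=
  (EuclideanSpace.proj (𝕜 := ℝ) i).hasFDerivAt

theorem hasFDerivAt_coord_mul {p p' q q' : ℝ → ℝ} (hp : ∀ t, HasDerivAt p (p' t) t)
    (hq : ∀ t, HasDerivAt q (q' t) t) (i j : Fin 2) (x : Plane) :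
    HasFDerivAt (fun x : Plane => p (x i) * q (x j))
      ((p' (x i) * q (x j)) • EuclideanSpace.proj (𝕜 := ℝ) i +
        (p (x i) * q' (x j)) • EuclideanSpace.proj (𝕜 := ℝ) j) x := by
  refine (((hp _).comp_hasFDerivAt x (hasFDerivAt_coord i x)).mul
    ((hq _).comp_hasFDerivAt x (hasFDerivAt_coord j x))).congr_fderiv ?_
  ext v
  simp
  ring

theorem laplacian_coord_mul {p p' p'' q q' q'' : ℝ → ℝ} (hp : ∀ t, HasDerivAt p (p' t) t)
    (hp' : ∀ t, HasDerivAt p' (p'' t) t) (hq : ∀ t, HasDerivAt q (q' t) t)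
    (hq' : ∀ t, HasDerivAt q' (q'' t) t) {i j : Fin 2} (hij : i ≠ j) (x : Plane) :
    Δ (fun x : Plane => p (x i) * q (x j)) x = p'' (x i) * q (x j) + p (x i) * q'' (x j) := by
  have hfst : fderiv ℝ (fun x : Plane => p (x i) * q (x j)) = fun x =>
      (p' (x i) * q (x j)) • EuclideanSpace.proj (𝕜 := ℝ) i +
        (p (x i) * q' (x j)) • EuclideanSpace.proj (𝕜 := ℝ) j :=
    funext fun x => (hasFDerivAt_coord_mul hp hq i j x).fderiv
  have hsnd := ((hasFDerivAt_coord_mul hp' hq i j x).smul_const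
    (EuclideanSpace.proj (𝕜 := ℝ) i : Plane →L[ℝ] ℝ)).fun_add
    ((hasFDerivAt_coord_mul hp hq' i j x).smul_const
      (EuclideanSpace.proj (𝕜 := ℝ) j : Plane →L[ℝ] ℝ))
  rw [laplacian_eq_sum_fderiv, hfst, hsnd.fderiv]
  fin_cases i <;> fin_cases j <;> simp_all [frame]
  ring

/-! ### One-forms in coordinates -/

/-- The coefficient of `dxᵢ` in a one-form. -/
def coeff (i : Fin 2) (ω : Form 1) (x : Plane) : ℝ := ω x fun _ => frame i

/-- The one-form `∑ᵢ fᵢ dxᵢ`. -/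
def oneForm (f : Fin 2 → Plane → ℝ) : Form 1 := fun x =>
  ∑ i, f i x • ContinuousAlternatingMap.ofSubsingleton ℝ Plane ℝ 0 (EuclideanSpace.proj i)

theorem oneForm_apply (f : Fin 2 → Plane → ℝ) (x : Plane) (v : Fin 1 → Plane) :
    oneForm f x v = ∑ i, f i x * v 0 i := by
  simp [oneForm]

@[simp]
theorem coeff_oneForm (f : Fin 2 → Plane → ℝ) (i : Fin 2) : coeff i (oneForm f) = f i := by
  ext x
  simp [coeff, oneForm_apply, frame]

theorem alternating_apply_eq_sum (a : Plane [⋀^Fin 1]→L[ℝ] ℝ) (v : Plane) :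
    (a fun _ => v) = ∑ i, (a fun _ => frame i) * v i := by
  obtain ⟨l, rfl⟩ := (ContinuousAlternatingMap.ofSubsingleton ℝ Plane ℝ (0 : Fin 1)).surjective a
  have hv : v = ∑ i, v i • frame i := by
    ext i
    fin_cases i <;> simp [frame]
  change l v = ∑ i, l (frame i) * v i
  conv_lhs => rw [hv]
  simp [mul_comm]

theorem oneForm_coeff (ω : Form 1) : oneForm (fun i => coeff i ω) = ω := by
  ext x v
  rw [oneForm_apply, show v = fun _ => v 0 from funext fun k => congrArg v (Subsingleton.elim k 0)]
  exact (alternating_apply_eq_sum (ω x) (v 0)).symm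

theorem form_one_ext {ω η : Form 1} (h : ∀ i x, coeff i ω x = coeff i η x) : ω = η := by
  rw [← oneForm_coeff ω, ← oneForm_coeff η]
  exact congrArg oneForm (funext₂ h)

theorem formInner_one (ω η : Form 1) (x : Plane) :
    formInner (ω x) (η x) = ∑ i, coeff i ω x * coeff i η x := by
  rw [formInner, Nat.factorial_one, Nat.cast_one, inv_one, one_mul,
    ← (Equiv.funUnique (Fin 1) (Fin 2)).symm.sum_comp]
  rfl

theorem coeff_pullback (g : Motion) (ω : Form 1) (i : Fin 2) (x : Plane) :
    coeff i (pullback g ω) x = ∑ j, coeff j ω (g x) * linearPart g (frame i) j :=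
  alternating_apply_eq_sum (ω (g x)) (linearPart g (frame i))

theorem contDiff_one_iff {n : WithTop ℕ∞} {ω : Form 1} :
    ContDiff ℝ n ω ↔ ∀ i, ContDiff ℝ n (coeff i ω) := by
  refine ⟨fun h i => ContDiff.comp (g := ContinuousAlternatingMap.apply ℝ Plane ℝ fun _ => frame i)
    (ContinuousLinearMap.contDiff _) h, fun h => ?_⟩
  rw [← oneForm_coeff ω]
  exact ContDiff.sum fun i _ => (h i).smul contDiff_const

theorem hodgeLaplacian_one_eq_smul_iff {ω : Form 1} (hω : ContDiff ℝ 2 ω) {μ : ℝ} :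
    (∀ x, hodgeLaplacian ω x = μ • ω x) ↔ ∀ i x, Δ (coeff i ω) x = -(μ * coeff i ω x) := by
  have hcoeff (i x) : Δ (coeff i ω) x = -coeff i (hodgeLaplacian ω) x := by
    have hcomp := hω.contDiffAt.laplacian_CLM_comp_left (x := x)
      (l := ContinuousAlternatingMap.apply ℝ Plane ℝ fun _ => frame i)
    refine hcomp.trans ?_
    simp [coeff, hodgeLaplacian_eq_neg_laplacian hω.contDiffAt]
  simp only [hcoeff, neg_inj]
  exact ⟨fun h i x => by simp [coeff, h],
    fun h => congrFun (form_one_ext (η := fun x => μ • ω x) h)⟩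

/-! ### Reflections and absolute boundary conditions -/

theorem contDiff_motion (g : Motion) {n : WithTop ℕ∞} : ContDiff ℝ n g := by
  have hg : ⇑g = fun x => linearPart g x + g 0 := funext (motion_apply g)
  rw [hg]
  exact (linearPart g).contDiff.add contDiff_const

theorem fderiv_motion (g : Motion) (x : Plane) :
    fderiv ℝ g x = (g.linearIsometryEquiv : Plane →L[ℝ] Plane) := by
  have hg : ⇑g = fun x => (g.linearIsometryEquiv : Plane →L[ℝ] Plane) x + g 0 :=
    funext (motion_apply g)
  rw [hg, fderiv_add_const, ContinuousLinearMap.fderiv]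

theorem extDeriv_pullback_motion {p : ℕ} {ω : Form p} (hω : Differentiable ℝ ω) (g : Motion) :
    extDeriv (pullback g ω) = pullback g (extDeriv ω) := by
  ext1 x
  have h := extDeriv_pullback (hω (g x)) (contDiff_motion g (n := 2)).contDiffAt (by simp)
  simp only [fderiv_motion] at h
  exact h

theorem normalPart_eq_zero_of_reflection {p : ℕ} {ν : Plane} {r : Orth} (hν : r ν = -ν)
    (hr : ∀ v ∈ (Submodule.span ℝ {ν})ᗮ, r v = v) {a : Plane [⋀^Fin (p + 1)]→L[ℝ] ℝ}
    (ha : a.compContinuousLinearMap (r : Plane →L[ℝ] Plane) = a) : normalPart ν a = 0 := by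
  ext v
  have hcons : (r ∘ Fin.cons ν fun k => (v k : Plane)) = Fin.cons (-ν) fun k => (v k : Plane) := by
    rw [Fin.comp_cons, hν]
    exact congrArg _ (funext fun k => hr _ (v k).2)
  have hflip : normalPart ν a v = -normalPart ν a v := calc
    a (Fin.cons ν fun k => (v k : Plane))
      = a (r ∘ Fin.cons ν fun k => (v k : Plane)) := (DFunLike.congr_fun ha _).symm
    _ = a.curryLeft (-ν) fun k => (v k : Plane) := congrArg a hcons
    _ = -a.curryLeft ν (fun k => (v k : Plane)) := by rw [map_neg]; rfl
  simpa using self_eq_neg.1 hflip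

theorem normalPart_eq_zero_of_pullback_eq {p : ℕ} {ω : Form (p + 1)}
    (hω : ∀ g ∈ squareGroup, pullback g ω = ω) {i : Fin 2} {x : Plane} (hx : OnEdge i x) :
    normalPart (frame i) (ω x) = 0 := by
  have hmem : signChange (Function.update 1 i (-1)) ∈ isotropy squareGroup x := by
    refine (mem_isotropy_squareGroup hx.1).2 ⟨_, fun j => ?_, rfl⟩
    rcases eq_or_ne j i with rfl | hj
    exacts [.inr hx, .inl (Function.update_of_ne hj _ _)]
  obtain ⟨g, ⟨hg, hgx⟩, hlin⟩ := hmem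
  refine normalPart_eq_zero_of_reflection (r := linearPart g) ?_ (fun v hv => ?_) ?_
  · ext j
    rcases eq_or_ne j i with rfl | hj <;> simp [frame, *]
  · have hvi : v i = 0 := by
      simpa [frame, EuclideanSpace.inner_single_left] using
        (Submodule.mem_orthogonal_singleton_iff_inner_right).1 hv
    ext j
    rcases eq_or_ne j i with rfl | hj <;> simp [*]
  · have hx' : pullback g ω x = ω x := congrFun (hω g hg) x
    rwa [pullback, show g x = x from hgx] at hx'

theorem absoluteBoundary_of_pullback_eq {p : ℕ} {ω : Form p} (hd : Differentiable ℝ ω)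
    (hω : ∀ g ∈ squareGroup, pullback g ω = ω) : AbsoluteBoundary ω := by
  have hext (g) (hg : g ∈ squareGroup) : pullback g (extDeriv ω) = extDeriv ω := by
    rw [← extDeriv_pullback_motion hd, hω g hg]
  match p, ω, hω, hext with
  | 0, _, _, hext => exact fun i x hx => normalPart_eq_zero_of_pullback_eq hext hx
  | _ + 1, _, hω, hext =>
    exact fun i x hx =>
      ⟨normalPart_eq_zero_of_pullback_eq hω hx, normalPart_eq_zero_of_pullback_eq hext hx⟩

theorem orbifoldEigenforms_squareGroup_subset (p : ℕ) (μ : ℝ) :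
    orbifoldEigenforms p squareGroup μ ⊆ squareEigenforms p μ := fun _ ⟨hsmooth, hω, hμ⟩ =>
  ⟨hsmooth, absoluteBoundary_of_pullback_eq (hsmooth.differentiable (by simp)) hω, fun x _ => hμ x⟩

theorem IsEigenvalueList.mono {p : ℕ} {D : Set Plane} {Eig Eig' : ℝ → Set (Form p)} {lam : ℕ → ℝ}
    (h : IsEigenvalueList D Eig lam) (hsub : ∀ μ, Eig μ ⊆ Eig' μ) : IsEigenvalueList D Eig' lam :=
  let ⟨hnonneg, hmono, htop, φ, hφ, hrest⟩ := h
  ⟨hnonneg, hmono, htop, φ, fun i => hsub _ (hφ i), hrest⟩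

/-! ### Transplantation -/

/-- The reflection `(x, y) ↦ (y, x)`, a symmetry of the square. -/
def swap : Orth := LinearIsometryEquiv.piLpCongrLeft 2 ℝ ℝ (Equiv.swap 0 1)

@[simp]
theorem swap_apply (x : Plane) (i : Fin 2) : swap x i = x (Equiv.swap 0 1 i) := rfl

@[simp]
theorem swap_swap (x : Plane) : swap (swap x) = x := by
  ext i
  simp

theorem measurePreserving_swap : MeasurePreserving swap (volume.restrict square)
    (volume.restrict square) := by
  have hpre : swap ⁻¹' square = square := by
    ext x
    exact ⟨fun h i => by simpa using h (Equiv.swap 0 1 i), fun h i => h (Equiv.swap 0 1 i)⟩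
  simpa only [hpre] using
    swap.measurePreserving.restrict_preimage measurableSet_square

theorem setIntegral_comp_swap_mul (f g : Plane → ℝ) :
    ∫ x in square, f (swap x) * g x = ∫ x in square, f x * g (swap x) := by
  have h := measurePreserving_swap.integral_comp' (f := swap.toHomeomorph.toMeasurableEquiv)
    fun x => f x * g (swap x)
  rw [← h]
  simp

/-- The transplantation of one-forms from the square orbifold to the pillow: a pointwise orthogonal
combination of the coefficients, with the second one read off at the mirror image. -/
def transplant (ω : Form 1) : Form 1 :=
  oneForm ![(√2)⁻¹ • (coeff 0 ω + coeff 1 ω), (√2)⁻¹ • ((coeff 0 ω - coeff 1 ω) ∘ swap)]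

/-- The inverse, and adjoint in `L²`, of the transplantation. -/
def transplantInv (ω : Form 1) : Form 1 :=
  oneForm ![(√2)⁻¹ • (coeff 0 ω + coeff 1 ω ∘ swap), (√2)⁻¹ • (coeff 0 ω - coeff 1 ω ∘ swap)]

theorem coeff_zero_transplant (ω : Form 1) (x : Plane) :
    coeff 0 (transplant ω) x = (√2)⁻¹ * (coeff 0 ω x + coeff 1 ω x) :=
  congrFun (coeff_oneForm _ 0) x

theorem coeff_one_transplant (ω : Form 1) (x : Plane) :
    coeff 1 (transplant ω) x = (√2)⁻¹ * (coeff 0 ω (swap x) - coeff 1 ω (swap x)) :=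
  congrFun (coeff_oneForm _ 1) x

theorem coeff_zero_transplantInv (ω : Form 1) (x : Plane) :
    coeff 0 (transplantInv ω) x = (√2)⁻¹ * (coeff 0 ω x + coeff 1 ω (swap x)) :=
  congrFun (coeff_oneForm _ 0) x

theorem coeff_one_transplantInv (ω : Form 1) (x : Plane) :
    coeff 1 (transplantInv ω) x = (√2)⁻¹ * (coeff 0 ω x - coeff 1 ω (swap x)) :=
  congrFun (coeff_oneForm _ 1) x

theorem transplantInv_transplant (ω : Form 1) : transplantInv (transplant ω) = ω := by
  have h : (√2)⁻¹ * (√2)⁻¹ = (2 : ℝ)⁻¹ := by rw [← mul_inv, Real.mul_self_sqrt zero_le_two]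
  refine form_one_ext (Fin.forall_fin_two.2 ⟨fun x => ?_, fun x => ?_⟩)
  · rw [coeff_zero_transplantInv, coeff_zero_transplant, coeff_one_transplant, swap_swap]
    linear_combination 2 * coeff 0 ω x * h
  · rw [coeff_one_transplantInv, coeff_zero_transplant, coeff_one_transplant, swap_swap]
    linear_combination 2 * coeff 1 ω x * h

theorem transplant_transplantInv (ω : Form 1) : transplant (transplantInv ω) = ω := by
  have h : (√2)⁻¹ * (√2)⁻¹ = (2 : ℝ)⁻¹ := by rw [← mul_inv, Real.mul_self_sqrt zero_le_two]
  refine form_one_ext (Fin.forall_fin_two.2 ⟨fun x => ?_, fun x => ?_⟩)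
  · rw [coeff_zero_transplant, coeff_zero_transplantInv, coeff_one_transplantInv]
    linear_combination 2 * coeff 0 ω x * h
  · rw [coeff_one_transplant, coeff_zero_transplantInv, coeff_one_transplantInv, swap_swap]
    linear_combination 2 * coeff 1 ω x * h

theorem memLp_smul_const {α E : Type*} [MeasurableSpace α] [NormedAddCommGroup E] [NormedSpace ℝ E]
    {f : α → ℝ} {p : ENNReal} {μ : Measure α} (hf : MemLp f p μ) (c : E) :
    MemLp (fun x => f x • c) p μ :=
  (ContinuousLinearMap.toSpanSingleton ℝ c).comp_memLp' hf

theorem memLp_oneForm {f : Fin 2 → Plane → ℝ} {p : ENNReal} {μ : Measure Plane}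
    (hf : ∀ i, MemLp (f i) p μ) : MemLp (oneForm f) p μ := by
  let dx (i : Fin 2) : Plane [⋀^Fin 1]→L[ℝ] ℝ :=
    ContinuousAlternatingMap.ofSubsingleton ℝ Plane ℝ 0 (EuclideanSpace.proj i)
  exact memLp_finsetSum Finset.univ (f := fun i x => f i x • dx i)
    fun i _ => memLp_smul_const (hf i) (dx i)

theorem memLp_one_iff {ω : Form 1} {p : ENNReal} {μ : Measure Plane} :
    MemLp ω p μ ↔ ∀ i, MemLp (coeff i ω) p μ := by
  constructor
  · intro h i
    change MemLp (ContinuousAlternatingMap.apply ℝ Plane ℝ (fun _ => frame i) ∘ ω) p μ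
    exact ContinuousLinearMap.comp_memLp' _ h
  · intro h
    rw [← oneForm_coeff ω]
    exact memLp_oneForm h

theorem memLp_transplant {ω : Form 1} (hω : MemLp ω 2 (volume.restrict square)) :
    MemLp (transplant ω) 2 (volume.restrict square) := by
  rw [memLp_one_iff] at hω ⊢
  rw [transplant, Fin.forall_fin_two, coeff_oneForm, coeff_oneForm]
  exact ⟨((hω 0).add (hω 1)).const_smul _,
    (((hω 0).sub (hω 1)).comp_measurePreserving measurePreserving_swap).const_smul _⟩

theorem memLp_transplantInv {ω : Form 1} (hω : MemLp ω 2 (volume.restrict square)) :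
    MemLp (transplantInv ω) 2 (volume.restrict square) := by
  rw [memLp_one_iff] at hω ⊢
  have hswap := (hω 1).comp_measurePreserving measurePreserving_swap
  rw [transplantInv, Fin.forall_fin_two, coeff_oneForm, coeff_oneForm]
  exact ⟨((hω 0).add hswap).const_smul _, ((hω 0).sub hswap).const_smul _⟩

theorem transplant_ae_eq_zero {ω : Form 1} (hω : ω =ᵐ[volume.restrict square] 0) :
    transplant ω =ᵐ[volume.restrict square] 0 := by
  filter_upwards [hω, measurePreserving_swap.quasiMeasurePreserving.ae hω] with x hx hsx
  ext v
  simp_all [transplant, oneForm_apply, coeff]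

theorem setIntegral_formInner_transplant {ω η : Form 1}
    (hω : MemLp ω 2 (volume.restrict square)) (hη : MemLp η 2 (volume.restrict square)) :
    ∫ x in square, formInner (ω x) (transplant η x) =
      ∫ x in square, formInner (transplantInv ω x) (η x) := by
  have hω' := memLp_one_iff.1 hω
  have hη' := memLp_one_iff.1 hη
  have hswap := (hω' 1).comp_measurePreserving measurePreserving_swap
  have htrans := memLp_one_iff.1 (memLp_transplant hη)
  simp only [formInner_one, Fin.sum_univ_two]
  have hfst : Integrable (fun x => coeff 0 ω x * coeff 0 (transplant η) x)
      (volume.restrict square) := (hω' 0).integrable_mul (htrans 0)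
  have hsnd : Integrable (fun x => coeff 1 ω x * coeff 1 (transplant η) x)
      (volume.restrict square) := (hω' 1).integrable_mul (htrans 1)
  have hsnd' : Integrable (fun x => ((√2)⁻¹ • (coeff 0 η - coeff 1 η)) x * coeff 1 ω (swap x))
      (volume.restrict square) := (((hη' 0).sub (hη' 1)).const_smul _).integrable_mul hswap
  calc ∫ x in square, (coeff 0 ω x * coeff 0 (transplant η) x +
        coeff 1 ω x * coeff 1 (transplant η) x)
    _ = (∫ x in square, coeff 0 ω x * coeff 0 (transplant η) x) +
        ∫ x in square, ((√2)⁻¹ • (coeff 0 η - coeff 1 η)) (swap x) * coeff 1 ω x := by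
      rw [integral_add hfst hsnd]
      simp [transplant, mul_comm]
    _ = ∫ x in square, (coeff 0 ω x * coeff 0 (transplant η) x +
        ((√2)⁻¹ • (coeff 0 η - coeff 1 η)) x * coeff 1 ω (swap x)) := by
      rw [setIntegral_comp_swap_mul, integral_add hfst hsnd']
    _ = _ := by
      refine integral_congr_ae (Eventually.of_forall fun x => ?_)
      simp only [coeff_zero_transplant, coeff_zero_transplantInv, coeff_one_transplantInv,
        Pi.smul_apply, Pi.sub_apply, smul_eq_mul]
      ring

theorem IsEigenvalueList.transplant {Eig Eig' : ℝ → Set (Form 1)} {lam : ℕ → ℝ}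
    (h : IsEigenvalueList square Eig lam) (hsub : ∀ μ, ∀ ω ∈ Eig μ, transplant ω ∈ Eig' μ) :
    IsEigenvalueList square Eig' lam := by
  obtain ⟨hnonneg, hmono, htop, φ, hφ, hmem, hortho, hcomplete⟩ := h
  refine ⟨hnonneg, hmono, htop, fun i => FlatOrbifold.transplant (φ i), fun i => hsub _ _ (hφ i),
    fun i => memLp_transplant (hmem i), fun i j => ?_, fun ω hω hperp => ?_⟩
  · rw [setIntegral_formInner_transplant (memLp_transplant (hmem i)) (hmem j),
      transplantInv_transplant, hortho]
  · have hinv := hcomplete _ (memLp_transplantInv hω) fun i => by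
      rw [← setIntegral_formInner_transplant hω (hmem i), hperp]
    simpa only [transplant_transplantInv] using transplant_ae_eq_zero hinv

theorem exists_mem_squareGroup (ε : Fin 2 → ℤˣ) (n : Fin 2 → ℤ) :
    ∃ g ∈ squareGroup, ∀ x i, g x i = ε i * x i + n i :=
  ⟨motionOf (signChange ε) (WithLp.toLp 2 fun i => n i), mem_squareGroup.2 ⟨ε, n, by simp⟩, by simp⟩

theorem pullback_eq_self_iff_coeff {g : Motion} {ε : Fin 2 → ℤˣ} {n : Fin 2 → ℤ}
    (hg : ∀ x i, g x i = ε i * x i + n i) {ω : Form 1} :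
    pullback g ω = ω ↔ ∀ i x, coeff i ω (g x) = ε i * coeff i ω x := by
  have hlin (v : Plane) (i) : linearPart g v i = ε i * v i := by
    rw [eq_sub_of_add_eq (motion_apply g v).symm, PiLp.sub_apply, hg, hg]
    simp
  have hcoeff (i x) : coeff i (pullback g ω) x = coeff i ω (g x) * ε i := by
    simp [coeff_pullback, hlin, frame]
  have hε (i) : (ε i : ℝ) * ε i = 1 := by exact_mod_cast Int.units_coe_mul_self (ε i)
  refine ⟨fun h i x => ?_, fun h => form_one_ext fun i x => ?_⟩
  · rw [← congrArg (fun η => coeff i η x) h, hcoeff, mul_left_comm, hε, mul_one]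
  · rw [hcoeff, h, mul_right_comm, hε, one_mul]

theorem coeff_eq_mul_of_pullback_eq {ω : Form 1} (hω : ∀ g ∈ squareGroup, pullback g ω = ω)
    (ε : Fin 2 → ℤˣ) (n : Fin 2 → ℤ) {x y : Plane} (hy : ∀ i, y i = ε i * x i + n i) (i : Fin 2) :
    coeff i ω y = ε i * coeff i ω x := by
  obtain ⟨g, hg, happly⟩ := exists_mem_squareGroup ε n
  obtain rfl : g x = y := PiLp.ext fun j => by rw [happly, hy]
  exact (pullback_eq_self_iff_coeff happly).1 (hω g hg) i x

theorem coeff_transplant_eq_mul {ω : Form 1} (hω : ∀ g ∈ squareGroup, pullback g ω = ω)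
    (ε : ℤˣ) (n : Fin 2 → ℤ) {x y : Plane} (hy : ∀ i, y i = ε * x i + n i) (i : Fin 2) :
    coeff i (transplant ω) y = ε * coeff i (transplant ω) x := by
  have hcoeff := coeff_eq_mul_of_pullback_eq hω (fun _ => ε) n hy
  have hswap := coeff_eq_mul_of_pullback_eq hω (fun _ => ε) (fun i => n (Equiv.swap 0 1 i))
    (x := swap x) (y := swap y) fun i => hy _
  fin_cases i
  · change coeff 0 (transplant ω) y = ε * coeff 0 (transplant ω) x
    rw [coeff_zero_transplant, coeff_zero_transplant, hcoeff, hcoeff]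
    ring
  · change coeff 1 (transplant ω) y = ε * coeff 1 (transplant ω) x
    rw [coeff_one_transplant, coeff_one_transplant, hswap, hswap]
    ring

theorem coeff_transplant_quarterTurn {ω : Form 1} (hω : ∀ g ∈ squareGroup, pullback g ω = ω)
    (x : Plane) : coeff 0 (transplant ω) (quarterTurn x) = -coeff 1 (transplant ω) x ∧
      coeff 1 (transplant ω) (quarterTurn x) = coeff 0 (transplant ω) x := by
  have hturn := coeff_eq_mul_of_pullback_eq hω ![-1, 1] 0 (x := swap x) (y := quarterTurn x)
    (Fin.forall_fin_two.2 ⟨by simp, by simp⟩)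
  have hswap := coeff_eq_mul_of_pullback_eq hω ![1, -1] 0 (x := x) (y := swap (quarterTurn x))
    (Fin.forall_fin_two.2 ⟨by simp, by simp⟩)
  constructor
  · rw [coeff_zero_transplant, coeff_one_transplant, hturn, hturn]
    simp only [Matrix.cons_val_zero, Matrix.cons_val_one]
    push_cast
    ring
  · rw [coeff_one_transplant, coeff_zero_transplant, hswap, hswap]
    simp only [Matrix.cons_val_zero, Matrix.cons_val_one]
    push_cast
    ring

theorem pullback_transplant {ω : Form 1} (hω : ∀ g ∈ squareGroup, pullback g ω = ω) :
    ∀ g ∈ pillowGroup, pullback g (transplant ω) = transplant ω := by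
  intro g hg
  obtain ⟨ε, n, h⟩ := mem_pillowGroup.1 hg
  have hε : (ε : ℝ) * ε = 1 := by exact_mod_cast Int.units_coe_mul_self ε
  have hlin (v : Plane) (i) : linearPart g v i = g v i - g 0 i :=
    eq_sub_of_add_eq (congrArg (fun y : Plane => y i) (motion_apply g v)).symm
  refine form_one_ext fun i x => ?_
  rw [coeff_pullback]
  rcases h with h | h
  · simp only [coeff_transplant_eq_mul hω ε n (h x), hlin, h]
    fin_cases i <;> simp [frame] <;> linear_combination coeff _ (transplant ω) x * hε
  · obtain ⟨hfst, hsnd⟩ := coeff_transplant_quarterTurn hω x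
    simp only [coeff_transplant_eq_mul hω ε n (h x), hlin, h, Fin.sum_univ_two, hfst, hsnd]
    fin_cases i <;> simp [frame] <;> linear_combination coeff _ (transplant ω) x * hε

theorem transplant_mem_orbifoldEigenforms {μ : ℝ} {ω : Form 1}
    (hω : ω ∈ orbifoldEigenforms 1 squareGroup μ) :
    transplant ω ∈ orbifoldEigenforms 1 pillowGroup μ := by
  obtain ⟨hsmooth, hinv, hμ⟩ := hω
  have hcoeff := contDiff_one_iff.1 hsmooth
  have hcoeff₂ (i) : ContDiff ℝ 2 (coeff i ω) := contDiff_infty.1 (hcoeff i) 2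
  have hadd : ContDiff ℝ 2 (coeff 0 ω + coeff 1 ω) := (hcoeff₂ 0).add (hcoeff₂ 1)
  have hsub : ContDiff ℝ 2 (coeff 0 ω - coeff 1 ω) := (hcoeff₂ 0).sub (hcoeff₂ 1)
  have htrans : ContDiff ℝ (⊤ : ℕ∞) (transplant ω) := by
    rw [contDiff_one_iff, Fin.forall_fin_two, transplant, coeff_oneForm, coeff_oneForm]
    exact ⟨((hcoeff 0).add (hcoeff 1)).const_smul (√2)⁻¹,
      (((hcoeff 0).sub (hcoeff 1)).comp swap.contDiff).const_smul (√2)⁻¹⟩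
  have hΔ := (hodgeLaplacian_one_eq_smul_iff (contDiff_infty.1 hsmooth 2)).1 hμ
  refine ⟨htrans, pullback_transplant hinv,
    (hodgeLaplacian_one_eq_smul_iff (contDiff_infty.1 htrans 2)).2 ?_⟩
  rw [Fin.forall_fin_two]
  refine ⟨fun x => ?_, fun x => ?_⟩ <;> simp only [transplant, coeff_oneForm]
  · change Δ ((√2)⁻¹ • (coeff 0 ω + coeff 1 ω)) x = -(μ * ((√2)⁻¹ * (coeff 0 ω x + coeff 1 ω x)))
    rw [InnerProductSpace.laplacian_smul _ hadd.contDiffAt,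
      (hcoeff₂ 0).contDiffAt.laplacian_add (hcoeff₂ 1).contDiffAt, hΔ, hΔ, smul_eq_mul]
    ring
  · change Δ ((√2)⁻¹ • ((coeff 0 ω - coeff 1 ω) ∘ swap)) x =
      -(μ * ((√2)⁻¹ * (coeff 0 ω (swap x) - coeff 1 ω (swap x))))
    rw [InnerProductSpace.laplacian_smul _ (hsub.comp swap.contDiff).contDiffAt,
      laplacian_comp_linearIsometryEquiv hsub,
      (hcoeff₂ 0).contDiffAt.laplacian_sub (hcoeff₂ 1).contDiffAt, hΔ, hΔ, smul_eq_mul]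
    ring

/-! ### Trigonometric modes -/

theorem sinTwoPi_mul_sinTwoPi (s t : ℝ) :
    sinTwoPi s * sinTwoPi t = (cosTwoPi (s - t) - cosTwoPi (s + t)) / 2 := by
  simp only [sinTwoPi, cosTwoPi, mul_add, mul_sub, Real.cos_add, Real.cos_sub]
  ring

theorem cosTwoPi_mul_cosTwoPi (s t : ℝ) :
    cosTwoPi s * cosTwoPi t = (cosTwoPi (s - t) + cosTwoPi (s + t)) / 2 := by
  simp only [cosTwoPi, mul_add, mul_sub, Real.cos_add, Real.cos_sub]
  ring

theorem sinTwoPi_mul_cosTwoPi (s t : ℝ) :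
    sinTwoPi s * cosTwoPi t = (sinTwoPi (s - t) + sinTwoPi (s + t)) / 2 := by
  simp only [sinTwoPi, cosTwoPi, mul_add, mul_sub, Real.sin_add, Real.sin_sub]
  ring

theorem sinTwoPi_neg (t : ℝ) : sinTwoPi (-t) = -sinTwoPi t := by
  rw [sinTwoPi, mul_neg, Real.sin_neg, sinTwoPi]

theorem sinTwoPi_pos {t : ℝ} (h0 : 0 < t) (h1 : t < 1 / 2) : 0 < sinTwoPi t :=
  Real.sin_pos_of_pos_of_lt_pi (by positivity) (by nlinarith [Real.pi_pos])

theorem hasDerivAt_sinTwoPi_mul (c t : ℝ) :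
    HasDerivAt (fun t => sinTwoPi (c * t)) (2 * Real.pi * c * cosTwoPi (c * t)) t := by
  simpa [sinTwoPi, cosTwoPi, mul_comm] using
    ((((hasDerivAt_id t).const_mul c).const_mul (2 * Real.pi)).sin)

theorem hasDerivAt_cosTwoPi_mul (c t : ℝ) :
    HasDerivAt (fun t => cosTwoPi (c * t)) (-(2 * Real.pi * c * sinTwoPi (c * t))) t := by
  simpa [sinTwoPi, cosTwoPi, mul_comm] using
    ((((hasDerivAt_id t).const_mul c).const_mul (2 * Real.pi)).cos)

theorem sinTwoPi_int_mul_unit_mul_add_int (m : ℤ) (ε : ℤˣ) (t : ℝ) (n : ℤ) :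
    sinTwoPi (m * (ε * t + n)) = ε * sinTwoPi (m * t) := by
  rw [← sinTwoPi_unit_mul_add_int ε (m * t) (m * n)]
  push_cast
  ring_nf

theorem cosTwoPi_int_mul_unit_mul_add_int (m : ℤ) (ε : ℤˣ) (t : ℝ) (n : ℤ) :
    cosTwoPi (m * (ε * t + n)) = cosTwoPi (m * t) := by
  rw [← cosTwoPi_unit_mul_add_int ε (m * t) (m * n)]
  push_cast
  ring_nf

/-- The trigonometric mode `x ↦ sin (2 π m xⱼ) cos (2 π n xₖ)` with `k ≠ j`. -/
def sinCos (j : Fin 2) (m n : ℤ) : C(Plane, ℝ) where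
  toFun x := sinTwoPi (m * x j) * cosTwoPi (n * x (Equiv.swap 0 1 j))
  continuous_toFun := by fun_prop

theorem sinCos_apply (j : Fin 2) (m n : ℤ) (x : Plane) :
    sinCos j m n x = sinTwoPi (m * x j) * cosTwoPi (n * x (Equiv.swap 0 1 j)) := rfl

theorem contDiff_sinCos (j : Fin 2) (m n : ℤ) {k : WithTop ℕ∞} : ContDiff ℝ k (sinCos j m n) := by
  change ContDiff ℝ k fun x : Plane =>
    Real.sin (2 * Real.pi * (m * x j)) * Real.cos (2 * Real.pi * (n * x (Equiv.swap 0 1 j)))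
  fun_prop

theorem sinCos_eq_mul (j : Fin 2) (m n : ℤ) (ε : Fin 2 → ℤˣ) (k : Fin 2 → ℤ) {x y : Plane}
    (hy : ∀ i, y i = ε i * x i + k i) : sinCos j m n y = ε j * sinCos j m n x := by
  simp only [sinCos_apply, hy, sinTwoPi_int_mul_unit_mul_add_int,
    cosTwoPi_int_mul_unit_mul_add_int, mul_assoc]

theorem laplacian_sinCos (j : Fin 2) (m n : ℤ) (x : Plane) :
    Δ (⇑(sinCos j m n)) x =
      -(((2 * Real.pi * m) ^ 2 + (2 * Real.pi * n) ^ 2) * sinCos j m n x) := by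
  have h := laplacian_coord_mul (hasDerivAt_sinTwoPi_mul m)
    (fun t => (hasDerivAt_cosTwoPi_mul m t).const_mul (2 * Real.pi * m))
    (hasDerivAt_cosTwoPi_mul n)
    (fun t => ((hasDerivAt_sinTwoPi_mul n t).const_mul (2 * Real.pi * n)).neg)
    (i := j) (j := Equiv.swap 0 1 j) (by fin_cases j <;> simp) x
  refine h.trans ?_
  rw [sinCos_apply]
  ring

theorem sinCos_neg_left (j : Fin 2) (m n : ℤ) : sinCos j (-m) n = -sinCos j m n := by
  ext x
  simp [sinCos_apply, sinTwoPi_neg]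

theorem sinCos_neg_right (j : Fin 2) (m n : ℤ) : sinCos j m (-n) = sinCos j m n := by
  ext x
  simp [sinCos_apply, cosTwoPi_neg]

theorem sinCos_zero_left (j : Fin 2) (n : ℤ) : sinCos j 0 n = 0 := by
  ext x
  simp [sinCos_apply, sinTwoPi_zero]

theorem sinCos_one_zero (j : Fin 2) (x : Plane) : sinCos j 1 0 x = sinTwoPi (x j) := by
  simp [sinCos_apply, cosTwoPi_zero]

/-! ### Orthogonality -/

theorem setIntegral_square_coord_mul (p q : ℝ → ℝ) (j : Fin 2) :
    ∫ x in square, p (x j) * q (x (Equiv.swap 0 1 j)) =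
      (∫ t in 0..1 / 2, p t) * ∫ t in 0..1 / 2, q t := by
  have hzero (p q : ℝ → ℝ) : ∫ x in square, p (x 0) * q (x 1) =
      (∫ t in 0..1 / 2, p t) * ∫ t in 0..1 / 2, q t := by
    let e : Plane ≃ᵐ ℝ × ℝ :=
      (MeasurableEquiv.toLp 2 (Fin 2 → ℝ)).symm.trans MeasurableEquiv.finTwoArrow
    have he : MeasurePreserving e :=
      (EuclideanSpace.volume_preserving_symm_measurableEquiv_toLp (Fin 2)).trans
        (volume_preserving_finTwoArrow ℝ)
    have hpre : square = e ⁻¹' (Set.Icc (0 : ℝ) (1 / 2) ×ˢ Set.Icc (0 : ℝ) (1 / 2)) := by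
      ext x
      exact Fin.forall_fin_two
    simp only [intervalIntegral.integral_of_le one_half_pos.le, ← integral_Icc_eq_integral_Ioc]
    rw [← setIntegral_prod_mul, hpre, ← Measure.volume_eq_prod]
    exact he.setIntegral_preimage_emb e.measurableEmbedding (fun z : ℝ × ℝ => p z.1 * q z.2) _
  fin_cases j
  · exact hzero p q
  · simpa [mul_comm] using hzero q p

theorem integral_cosTwoPi_int_mul (k : ℤ) :
    ∫ t in 0..1 / 2, cosTwoPi (k * t) = if k = 0 then 1 / 2 else 0 := by
  split_ifs with hk
  · simp [hk, cosTwoPi_zero]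
  · have hderiv (t : ℝ) :
        HasDerivAt (fun t => (2 * Real.pi * k)⁻¹ * sinTwoPi (k * t)) (cosTwoPi (k * t)) t := by
      have hk' : (2 * Real.pi * k : ℝ) ≠ 0 := by simp [hk, Real.pi_ne_zero]
      exact ((hasDerivAt_sinTwoPi_mul k t).const_mul (2 * Real.pi * k : ℝ)⁻¹).congr_deriv
        (inv_mul_cancel_left₀ hk' _)
    rw [intervalIntegral.integral_eq_sub_of_hasDerivAt (fun t _ => hderiv t)
      (Continuous.intervalIntegrable (by fun_prop) _ _),
      sinTwoPi_eq_zero_iff.2 ⟨k, by ring⟩, mul_zero (k : ℝ), sinTwoPi_zero, sub_self]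

theorem intervalIntegrable_cosTwoPi_mul (c a b : ℝ) :
    IntervalIntegrable (fun t => cosTwoPi (c * t)) volume a b :=
  Continuous.intervalIntegrable (by fun_prop) a b

theorem integral_sinTwoPi_mul_sinTwoPi (m n : ℕ) :
    ∫ t in 0..1 / 2, sinTwoPi ((m + 1 : ℤ) * t) * sinTwoPi ((n + 1 : ℤ) * t) =
      if m = n then 1 / 4 else 0 := by
  have hprod (t : ℝ) : sinTwoPi ((m + 1 : ℤ) * t) * sinTwoPi ((n + 1 : ℤ) * t) =
      (cosTwoPi ((m - n : ℤ) * t) - cosTwoPi ((m + n + 2 : ℤ) * t)) / 2 := by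
    rw [sinTwoPi_mul_sinTwoPi]
    push_cast
    ring_nf
  have hsum : (m + n + 2 : ℤ) ≠ 0 := by positivity
  simp only [hprod]
  rw [intervalIntegral.integral_div, intervalIntegral.integral_sub
    (intervalIntegrable_cosTwoPi_mul _ _ _) (intervalIntegrable_cosTwoPi_mul _ _ _),
    integral_cosTwoPi_int_mul, integral_cosTwoPi_int_mul, if_neg hsum]
  simp only [sub_eq_zero, Nat.cast_inj]
  split_ifs <;> norm_num

theorem integral_cosTwoPi_mul_cosTwoPi (m n : ℕ) :
    ∫ t in 0..1 / 2, cosTwoPi ((m : ℤ) * t) * cosTwoPi ((n : ℤ) * t) =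
      if m = n then if n = 0 then 1 / 2 else 1 / 4 else 0 := by
  have hprod (t : ℝ) : cosTwoPi ((m : ℤ) * t) * cosTwoPi ((n : ℤ) * t) =
      (cosTwoPi ((m - n : ℤ) * t) + cosTwoPi ((m + n : ℤ) * t)) / 2 := by
    rw [cosTwoPi_mul_cosTwoPi]
    push_cast
    ring_nf
  simp only [hprod]
  rw [intervalIntegral.integral_div, intervalIntegral.integral_add
    (intervalIntegrable_cosTwoPi_mul _ _ _) (intervalIntegrable_cosTwoPi_mul _ _ _),
    integral_cosTwoPi_int_mul, integral_cosTwoPi_int_mul]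
  simp only [sub_eq_zero, Nat.cast_inj, show (m + n : ℤ) = 0 ↔ m = 0 ∧ n = 0 by omega]
  split_ifs <;> first | omega | norm_num

theorem setIntegral_sinCos_mul_sinCos (j : Fin 2) (m n m' n' : ℕ) :
    ∫ x in square, sinCos j (m + 1) n x * sinCos j (m' + 1) n' x =
      if m = m' ∧ n = n' then if n = 0 then 1 / 8 else 1 / 16 else 0 := by
  simp only [sinCos_apply, mul_mul_mul_comm]
  rw [setIntegral_square_coord_mul
    (fun t => sinTwoPi ((m + 1 : ℤ) * t) * sinTwoPi ((m' + 1 : ℤ) * t))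
    (fun t => cosTwoPi ((n : ℤ) * t) * cosTwoPi ((n' : ℤ) * t)),
    integral_sinTwoPi_mul_sinTwoPi, integral_cosTwoPi_mul_cosTwoPi]
  split_ifs <;> first | omega | norm_num

/-! ### Completeness -/

theorem setIntegral_mul_eq_zero_of_separatesPoints {X : Type*} [TopologicalSpace X]
    [MeasurableSpace X] [OpensMeasurableSpace X] {μ : Measure X} {K : Set X} (hK : IsCompact K)
    (hKm : MeasurableSet K) {h : X → ℝ} (hh : IntegrableOn h K μ) {A : Subalgebra ℝ C(X, ℝ)}
    (hsep : ∀ x ∈ K, ∀ y ∈ K, x ≠ y → ∃ a ∈ A, a x ≠ a y)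
    (hA : ∀ a ∈ A, ∫ x in K, h x * a x ∂μ = 0) (φ : C(X, ℝ)) : ∫ x in K, h x * φ x ∂μ = 0 := by
  have := isCompact_iff_compactSpace.1 hK
  have hint (f : C(X, ℝ)) : IntegrableOn (fun x => h x * f x) K μ :=
    hh.mul_continuousOn_of_subset f.continuous.continuousOn hKm hK subset_rfl
  have happrox {ε : ℝ} (hε : 0 < ε) : ∃ a ∈ A, ∀ x ∈ K, |φ x - a x| ≤ ε := by
    let restrict := ContinuousMap.compRightAlgHom ℝ ℝ (⟨Subtype.val, by fun_prop⟩ : C(K, X))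
    have hsep' : (A.map restrict).SeparatesPoints := fun x y hxy =>
      let ⟨a, ha, hne⟩ := hsep x x.2 y y.2 (Subtype.coe_ne_coe.2 hxy)
      ⟨_, ⟨restrict a, ⟨a, ha, rfl⟩, rfl⟩, hne⟩
    obtain ⟨⟨_, a, ha, rfl⟩, hlt⟩ :=
      ContinuousMap.exists_mem_subalgebra_near_continuousMap_of_separatesPoints _ hsep'
        (restrict φ) ε hε
    refine ⟨a, ha, fun x hx => ?_⟩
    rw [abs_sub_comm]
    exact (ContinuousMap.norm_coe_le_norm (restrict a - restrict φ) ⟨x, hx⟩).trans hlt.le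
  have hbound {ε : ℝ} (hε : 0 < ε) : |∫ x in K, h x * φ x ∂μ| ≤ ε * ∫ x in K, |h x| ∂μ := by
    obtain ⟨a, ha, hle⟩ := happrox hε
    calc |∫ x in K, h x * φ x ∂μ| = |∫ x in K, (h x * φ x - h x * a x) ∂μ| := by
          rw [integral_sub (hint φ) (hint a), hA a ha, sub_zero]
      _ ≤ ∫ x in K, ε * |h x| ∂μ := by
          refine (Real.norm_eq_abs _).symm.trans_le
            (norm_integral_le_of_norm_le (hh.abs.const_mul ε) ?_)
          filter_upwards [ae_restrict_mem hKm] with x hx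
          rw [← mul_sub, norm_mul, mul_comm]
          exact mul_le_mul_of_nonneg_right (hle x hx) (abs_nonneg _)
      _ = ε * ∫ x in K, |h x| ∂μ := integral_const_mul ε _
  have hlim : Tendsto (fun ε : ℝ => ε * ∫ x in K, |h x| ∂μ) (nhdsWithin 0 (Set.Ioi 0)) (nhds 0) :=
    (tendsto_nhdsWithin_of_tendsto_nhds (Continuous.tendsto' (by fun_prop) _ _ (zero_mul _)))
  exact abs_nonpos_iff.1 (ge_of_tendsto hlim (eventually_mem_nhdsWithin.mono fun ε => hbound))

theorem mul_mem_of_mem_adjoin {R A : Type*} [CommSemiring R] [Semiring A] [Algebra R A] {s : Set A}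
    {V : Submodule R A} (hs : ∀ a ∈ s, ∀ v ∈ V, a * v ∈ V) {a : A} (ha : a ∈ Algebra.adjoin R s) :
    ∀ v ∈ V, a * v ∈ V := by
  induction ha using Algebra.adjoin_induction with
  | mem a ha => exact hs a ha
  | algebraMap r => exact fun v hv => Algebra.smul_def r v ▸ V.smul_mem r hv
  | add a b _ _ iha ihb => exact fun v hv => add_mul a b v ▸ V.add_mem (iha v hv) (ihb v hv)
  | mul a b _ _ iha ihb => exact fun v hv => mul_assoc a b v ▸ iha _ (ihb v hv)

/-- The function `x ↦ cos (2 π xᵢ)`; the two of them generate the algebra of polynomials in the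
cosines of the coordinates, which is dense on the square. -/
def cosCoord (i : Fin 2) : C(Plane, ℝ) where
  toFun x := cosTwoPi (x i)
  continuous_toFun := by fun_prop

theorem cosCoord_mul_sinCos (j : Fin 2) (m n : ℤ) :
    cosCoord j * sinCos j m n = (2⁻¹ : ℝ) • (sinCos j (m - 1) n + sinCos j (m + 1) n) := by
  ext x
  have h := sinTwoPi_mul_cosTwoPi (m * x j) (x j)
  simp only [ContinuousMap.mul_apply, ContinuousMap.smul_apply, ContinuousMap.add_apply,
    sinCos_apply, cosCoord, ContinuousMap.coe_mk, smul_eq_mul, Int.cast_sub, Int.cast_add,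
    Int.cast_one, sub_one_mul, add_one_mul]
  linear_combination cosTwoPi (n * x (Equiv.swap 0 1 j)) * h

theorem cosCoord_swap_mul_sinCos (j : Fin 2) (m n : ℤ) :
    cosCoord (Equiv.swap 0 1 j) * sinCos j m n =
      (2⁻¹ : ℝ) • (sinCos j m (n - 1) + sinCos j m (n + 1)) := by
  ext x
  have h := cosTwoPi_mul_cosTwoPi (n * x (Equiv.swap 0 1 j)) (x (Equiv.swap 0 1 j))
  simp only [ContinuousMap.mul_apply, ContinuousMap.smul_apply, ContinuousMap.add_apply,
    sinCos_apply, cosCoord, ContinuousMap.coe_mk, smul_eq_mul, Int.cast_sub, Int.cast_add,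
    Int.cast_one, sub_one_mul, add_one_mul]
  linear_combination sinTwoPi (m * x j) * h

/-- The span of the modes with positive frequency `m` and nonnegative frequency `n`. -/
def modeSpan (j : Fin 2) : Submodule ℝ C(Plane, ℝ) :=
  Submodule.span ℝ (Set.range fun k : ℕ × ℕ => sinCos j (k.1 + 1) k.2)

theorem sinCos_mem_modeSpan (j : Fin 2) (m n : ℤ) : sinCos j m n ∈ modeSpan j := by
  have hnat (a b : ℕ) : sinCos j a b ∈ modeSpan j := by
    rcases a with _ | a
    · simp [sinCos_zero_left]
    · exact Submodule.subset_span ⟨(a, b), by simp⟩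
  obtain ⟨a, rfl | rfl⟩ := m.eq_nat_or_neg <;> obtain ⟨b, rfl | rfl⟩ := n.eq_nat_or_neg <;>
    simp only [sinCos_neg_left, sinCos_neg_right, Submodule.neg_mem_iff, hnat]

theorem mul_mem_modeSpan (j : Fin 2) {a : C(Plane, ℝ)}
    (ha : a ∈ Algebra.adjoin ℝ (Set.range cosCoord)) {v : C(Plane, ℝ)} (hv : v ∈ modeSpan j) :
    a * v ∈ modeSpan j := by
  refine mul_mem_of_mem_adjoin ?_ ha v hv
  rintro _ ⟨i, rfl⟩ v hv
  induction hv using Submodule.span_induction with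
  | mem v hv =>
    obtain ⟨k, rfl⟩ := hv
    obtain rfl | rfl : i = j ∨ i = Equiv.swap 0 1 j := by
      fin_cases i <;> fin_cases j <;> simp
    · rw [cosCoord_mul_sinCos]
      exact Submodule.smul_mem _ _ (add_mem (sinCos_mem_modeSpan _ _ _) (sinCos_mem_modeSpan _ _ _))
    · rw [cosCoord_swap_mul_sinCos]
      exact Submodule.smul_mem _ _ (add_mem (sinCos_mem_modeSpan _ _ _) (sinCos_mem_modeSpan _ _ _))
  | zero => simp
  | add v w _ _ ihv ihw => exact mul_add (cosCoord i) v w ▸ add_mem ihv ihw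
  | smul c v _ ih => exact mul_smul_comm c (cosCoord i) v ▸ Submodule.smul_mem _ c ih

theorem exists_mem_adjoin_cosCoord_apply_ne {x y : Plane} (hx : x ∈ square) (hy : y ∈ square)
    (hxy : x ≠ y) : ∃ a ∈ Algebra.adjoin ℝ (Set.range cosCoord), a x ≠ a y := by
  by_contra! heq
  refine hxy (PiLp.ext fun i => ?_)
  obtain ⟨ε, n, h⟩ := cosTwoPi_eq_iff.1 (heq _ (Algebra.subset_adjoin ⟨i, rfl⟩))
  have hle := abs_sub_le_abs_sub_mul_add_int (hx i) (hy i) ε n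
  rwa [← h, sub_self, abs_zero, abs_nonpos_iff, sub_eq_zero] at hle

theorem setIntegral_mul_eq_zero_of_mem_modeSpan {h : Plane → ℝ} (hh : IntegrableOn h square)
    {j : Fin 2} (horth : ∀ m n : ℕ, ∫ x in square, h x * sinCos j (m + 1) n x = 0)
    {v : C(Plane, ℝ)} (hv : v ∈ modeSpan j) : ∫ x in square, h x * v x = 0 := by
  have hint (f : C(Plane, ℝ)) : IntegrableOn (fun x => h x * f x) square :=
    hh.mul_continuousOn f.continuous.continuousOn isCompact_square
  induction hv using Submodule.span_induction with
  | mem v hv =>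
    obtain ⟨k, rfl⟩ := hv
    exact horth k.1 k.2
  | zero => simp
  | add v w _ _ ihv ihw =>
    simp only [ContinuousMap.add_apply, mul_add]
    rw [integral_add (hint v) (hint w), ihv, ihw, add_zero]
  | smul c v _ ih =>
    simp only [ContinuousMap.smul_apply, smul_eq_mul, mul_left_comm _ c]
    rw [integral_const_mul, ih, mul_zero]

theorem ae_eq_zero_of_forall_setIntegral_mul_sinCos_eq_zero {h : Plane → ℝ}
    (hh : IntegrableOn h square) {j : Fin 2}
    (horth : ∀ m n : ℕ, ∫ x in square, h x * sinCos j (m + 1) n x = 0) :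
    h =ᵐ[volume.restrict square] 0 := by
  have hsin : IntegrableOn (fun x => h x * sinCos j 1 0 x) square :=
    hh.mul_continuousOn (sinCos j 1 0).continuous.continuousOn isCompact_square
  have horth' (a) (ha : a ∈ Algebra.adjoin ℝ (Set.range cosCoord)) :
      ∫ x in square, h x * sinCos j 1 0 x * a x = 0 := by
    simpa only [ContinuousMap.mul_apply, mul_assoc, mul_comm (a _)] using
      setIntegral_mul_eq_zero_of_mem_modeSpan hh horth
        (mul_mem_modeSpan j ha (sinCos_mem_modeSpan j 1 0))
  have hprod := ae_eq_zero_of_integral_contDiff_smul_eq_zero hsin.integrable.locallyIntegrable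
    fun φ hφ _ => by
      simpa only [smul_eq_mul, mul_comm, ContinuousMap.coe_mk] using
        setIntegral_mul_eq_zero_of_separatesPoints isCompact_square measurableSet_square hsin
          (fun x hx y hy => exists_mem_adjoin_cosCoord_apply_ne hx hy) horth' ⟨φ, hφ.continuous⟩
  filter_upwards [hprod, ae_restrict_of_ae ae_forall_not_onEdge,
    ae_restrict_mem measurableSet_square] with x hx hedge hsq
  have hpos := mem_Ioo_of_not_onEdge hsq (hedge j)
  rw [sinCos_one_zero] at hx
  exact (mul_eq_zero.1 hx).resolve_right (sinTwoPi_pos hpos.1 hpos.2).ne'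

/-! ### The spectrum -/

/-- The `1`-form `sin (2 π m x) cos (2 π n y) a₀ dx + cos (2 π n x) sin (2 π m y) a₁ dy`. -/
def sinCosForm (a : Fin 2 → ℝ) (m n : ℤ) : Form 1 := oneForm fun i x => a i * sinCos i m n x

theorem contDiff_sinCosForm (a : Fin 2 → ℝ) (m n : ℤ) {k : WithTop ℕ∞} :
    ContDiff ℝ k (sinCosForm a m n) := by
  rw [contDiff_one_iff]
  intro i
  rw [sinCosForm, coeff_oneForm]
  exact contDiff_const.mul (contDiff_sinCos i m n)

theorem sinCosForm_mem_orbifoldEigenforms (a : Fin 2 → ℝ) (m n : ℤ) :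
    sinCosForm a m n ∈ orbifoldEigenforms 1 squareGroup
      ((2 * Real.pi * m) ^ 2 + (2 * Real.pi * n) ^ 2) := by
  refine ⟨contDiff_sinCosForm a m n, fun g hg => ?_,
    (hodgeLaplacian_one_eq_smul_iff (contDiff_sinCosForm a m n)).2 fun i x => ?_⟩
  · obtain ⟨ε, k, hgx⟩ := mem_squareGroup.1 hg
    refine (pullback_eq_self_iff_coeff hgx).2 fun i x => ?_
    rw [sinCosForm, coeff_oneForm, sinCos_eq_mul i m n ε k (hgx x), mul_left_comm]
  · rw [sinCosForm, coeff_oneForm]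
    change Δ (a i • ⇑(sinCos i m n)) x = _
    rw [InnerProductSpace.laplacian_smul _ (contDiff_sinCos i m n).contDiffAt, laplacian_sinCos,
      smul_eq_mul]
    ring

theorem formInner_sinCosForm_single (ω : Form 1) (j : Fin 2) (c : ℝ) (m n : ℤ) (x : Plane) :
    formInner (ω x) (sinCosForm (Pi.single j c) m n x) = c * (coeff j ω x * sinCos j m n x) := by
  rw [formInner_one, Finset.sum_eq_single j]
  · rw [sinCosForm, coeff_oneForm, Pi.single_eq_same, mul_left_comm]
  · intro i _ hij
    simp [sinCosForm, hij]
  · simp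

/-- The factor that normalizes the modes of frequency `n` in the cosine. -/
def amplitude (n : ℕ) : ℝ := if n = 0 then 2 * √2 else 4

theorem amplitude_ne_zero (n : ℕ) : amplitude n ≠ 0 := by
  unfold amplitude
  split_ifs <;> positivity

theorem setIntegral_amplitude_mul_sinCos (j : Fin 2) (m n m' n' : ℕ) :
    amplitude n * amplitude n' * ∫ x in square, sinCos j (m + 1) n x * sinCos j (m' + 1) n' x =
      if m = m' ∧ n = n' then 1 else 0 := by
  rw [setIntegral_sinCos_mul_sinCos]
  split_ifs with h hn
  · rw [← h.2, hn, amplitude, if_pos rfl, mul_mul_mul_comm, Real.mul_self_sqrt zero_le_two]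
    norm_num
  · rw [← h.2, amplitude, if_neg hn]
    norm_num
  · exact mul_zero _

/-- The normalized eigenform on the square whose coefficient of `dxⱼ` is a multiple of
`sinCos j (m + 1) n` for `k = (j, m, n)`, and whose other coefficient is zero. -/
def squareMode (k : Fin 2 × ℕ × ℕ) : Form 1 :=
  sinCosForm (Pi.single k.1 (amplitude k.2.2)) (k.2.1 + 1) k.2.2

/-- The eigenvalue of `squareMode k`. -/
def squareModeEigenvalue (k : Fin 2 × ℕ × ℕ) : ℝ :=
  (2 * Real.pi * (k.2.1 + 1)) ^ 2 + (2 * Real.pi * k.2.2) ^ 2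

theorem squareMode_mem_orbifoldEigenforms (k : Fin 2 × ℕ × ℕ) :
    squareMode k ∈ orbifoldEigenforms 1 squareGroup (squareModeEigenvalue k) := by
  simpa [squareMode, squareModeEigenvalue] using
    sinCosForm_mem_orbifoldEigenforms (Pi.single k.1 (amplitude k.2.2)) (k.2.1 + 1) k.2.2

theorem tendsto_squareModeEigenvalue : Tendsto squareModeEigenvalue cofinite atTop := by
  refine tendsto_atTop.2 fun a => ?_
  have hfin := (Set.finite_univ (α := Fin 2)).prod
    ((Set.finite_Iic ⌊a⌋₊).prod (Set.finite_Iic ⌊a⌋₊))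
  refine hfin.subset fun ⟨j, m, n⟩ hk => ?_
  replace hk : squareModeEigenvalue (j, m, n) < a := not_le.1 hk
  have hle (b : ℕ) : (b : ℝ) ≤ (2 * Real.pi * b) ^ 2 := by
    have hπ : 1 ≤ (2 * Real.pi) ^ 2 := one_le_pow₀ (by linarith [Real.pi_gt_three])
    calc (b : ℝ) ≤ (b : ℝ) ^ 2 := by exact_mod_cast Nat.le_self_pow two_ne_zero b
      _ ≤ (2 * Real.pi) ^ 2 * (b : ℝ) ^ 2 := le_mul_of_one_le_left (sq_nonneg _) hπ
      _ = (2 * Real.pi * b) ^ 2 := (mul_pow _ _ _).symm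
  have hm := hle (m + 1)
  have hn := hle n
  push_cast at hm
  unfold squareModeEigenvalue at hk
  exact ⟨Set.mem_univ j, Nat.le_floor (by nlinarith), Nat.le_floor (by nlinarith)⟩

instance isFiniteMeasure_restrict_square :
    IsFiniteMeasure (volume.restrict square : Measure Plane) :=
  isFiniteMeasure_restrict.2 isCompact_square.measure_ne_top

theorem memLp_squareMode (k : Fin 2 × ℕ × ℕ) : MemLp (squareMode k) 2 (volume.restrict square) := by
  have hcont : Continuous (squareMode k) := (contDiff_sinCosForm (k := 0) _ _ _).continuous
  obtain ⟨C, hC⟩ := isCompact_square.exists_bound_of_continuousOn hcont.continuousOn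
  exact MemLp.of_bound hcont.aestronglyMeasurable C
    ((ae_restrict_iff' measurableSet_square).2 (Eventually.of_forall hC))

theorem setIntegral_formInner_squareMode (k l : Fin 2 × ℕ × ℕ) :
    ∫ x in square, formInner (squareMode k x) (squareMode l x) = if k = l then 1 else 0 := by
  obtain ⟨i, m, n⟩ := k
  obtain ⟨j, m', n'⟩ := l
  simp only [squareMode, formInner_sinCosForm_single, Prod.mk.injEq]
  rw [sinCosForm, coeff_oneForm]
  obtain rfl | hij := eq_or_ne i j
  · simp only [Pi.single_eq_same, mul_assoc, true_and, ← setIntegral_amplitude_mul_sinCos i]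
    rw [integral_const_mul, integral_const_mul]
    ring
  · simp [hij, hij.symm]

theorem ae_eq_zero_of_forall_setIntegral_formInner_squareMode_eq_zero {ω : Form 1}
    (hω : MemLp ω 2 (volume.restrict square))
    (h : ∀ k, ∫ x in square, formInner (ω x) (squareMode k x) = 0) :
    ω =ᵐ[volume.restrict square] 0 := by
  have hcoeff (j : Fin 2) : coeff j ω =ᵐ[volume.restrict square] 0 := by
    refine ae_eq_zero_of_forall_setIntegral_mul_sinCos_eq_zero (j := j)
      ((memLp_one_iff.1 hω j).integrable one_le_two) fun m n => ?_
    have hmode := h (j, m, n)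
    simp only [squareMode, formInner_sinCosForm_single] at hmode
    rw [integral_const_mul] at hmode
    exact (mul_eq_zero.1 hmode).resolve_left (amplitude_ne_zero n)
  filter_upwards [hcoeff 0, hcoeff 1] with x h0 h1
  have hx : ∀ i, coeff i ω x = 0 := Fin.forall_fin_two.2 ⟨h0, h1⟩
  rw [← oneForm_coeff ω]
  simp [oneForm, hx]

theorem exists_equiv_nat_strictMono {ι α : Type*} [Infinite ι] [LinearOrder α] {g : ι → α}
    (hg : Function.Injective g) (hfin : ∀ i, {k | g k < g i}.Finite) :
    ∃ e : ℕ ≃ ι, StrictMono (g ∘ e) := by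
  let rank (i : ι) : ℕ := {k | g k < g i}.ncard
  have hrank {i j : ι} (hij : g i < g j) : rank i < rank j :=
    Set.ncard_lt_ncard ⟨fun k hk => lt_trans hk hij, fun h => lt_irrefl (g i) (h hij)⟩ (hfin j)
  have hinj : Function.Injective rank := fun i j hij => by
    by_contra hne
    rcases (hg.ne hne).lt_or_gt with h | h
    exacts [(hrank h).ne hij, (hrank h).ne' hij]
  have := Set.infinite_range_of_injective hinj |>.to_subtype
  classical
  let e : ℕ ≃ ι := (Nat.Subtype.orderIsoOfNat (Set.range rank)).toEquiv.trans
    (Equiv.ofInjective rank hinj).symm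
  have he (n : ℕ) : rank (e n) = Nat.Subtype.orderIsoOfNat (Set.range rank) n :=
    Equiv.apply_ofInjective_symm hinj _
  refine ⟨e, fun m n hmn => lt_of_not_ge fun hle => ?_⟩
  have hlt : rank (e m) < rank (e n) := by
    rw [he, he]
    exact (Nat.Subtype.orderIsoOfNat (Set.range rank)).strictMono hmn
  rcases hle.lt_or_eq with h | h
  exacts [(hrank h).not_gt hlt, hlt.ne' (congrArg rank (hg h))]

theorem exists_equiv_nat_monotone {ι : Type*} [Infinite ι] {f : ι → ℝ}
    (hf : Tendsto f cofinite atTop) : ∃ e : ℕ ≃ ι, Monotone (f ∘ e) := by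
  obtain ⟨_, _⟩ := exists_wellFoundedLT ι
  have hfin (i : ι) : {k | toLex (f k, k) < toLex (f i, i)}.Finite := by
    refine Set.Finite.subset (hf.eventually_gt_atTop (f i)) fun k hk => ?_
    exact not_lt.2 ((Prod.Lex.toLex_lt_toLex.1 hk).elim le_of_lt fun h => h.1.le)
  obtain ⟨e, he⟩ := exists_equiv_nat_strictMono (g := fun i => toLex (f i, i))
    (fun i j h => congrArg Prod.snd (toLex.injective h)) hfin
  exact ⟨e, fun m n hmn => Prod.Lex.monotone_fst _ _ (he.monotone hmn)⟩

theorem exists_isEigenvalueList_of_family {ι : Type*} [Infinite ι] [DecidableEq ι] {p : ℕ}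
    {D : Set Plane} {Eig : ℝ → Set (Form p)} {μ : ι → ℝ} {φ : ι → Form p} (hμ : ∀ i, 0 ≤ μ i)
    (hlim : Tendsto μ cofinite atTop) (heig : ∀ i, φ i ∈ Eig (μ i))
    (hmem : ∀ i, MemLp (φ i) 2 (volume.restrict D))
    (hortho : ∀ i j, ∫ x in D, formInner (φ i x) (φ j x) = if i = j then 1 else 0)
    (hcomplete : ∀ ω : Form p, MemLp ω 2 (volume.restrict D) →
      (∀ i, ∫ x in D, formInner (ω x) (φ i x) = 0) → ω =ᵐ[volume.restrict D] 0) :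
    ∃ lam, IsEigenvalueList D Eig lam := by
  obtain ⟨e, he⟩ := exists_equiv_nat_monotone hlim
  refine ⟨μ ∘ e, fun n => hμ _, he, ?_, φ ∘ e, fun n => heig _, fun n => hmem _, fun m n => ?_,
    fun ω hω h => hcomplete ω hω (e.surjective.forall.2 h)⟩
  · exact hlim.comp (Nat.cofinite_eq_atTop ▸ e.injective.tendsto_cofinite)
  · simp only [Function.comp_apply, hortho, e.injective.eq_iff]

theorem exists_isEigenvalueList_squareGroup :
    ∃ lam, IsEigenvalueList square (orbifoldEigenforms 1 squareGroup) lam :=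
  exists_isEigenvalueList_of_family (φ := squareMode)
    (fun k => by unfold squareModeEigenvalue; positivity) tendsto_squareModeEigenvalue
    squareMode_mem_orbifoldEigenforms memLp_squareMode setIntegral_formInner_squareMode
    fun _ => ae_eq_zero_of_forall_setIntegral_formInner_squareMode_eq_zero

theorem exists_common_spectrum :
    ∃ lam : ℕ → ℝ, IsOrbifoldSpectrum 1 pillowGroup lam ∧ IsOrbifoldSpectrum 1 squareGroup lam ∧
      IsSquareAbsoluteSpectrum 1 lam :=
  let ⟨lam, h⟩ := exists_isEigenvalueList_squareGroup
  ⟨lam,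
    ⟨square, isFundamentalDomain_square_pillowGroup,
      h.transplant fun _ _ => transplant_mem_orbifoldEigenforms⟩,
    ⟨square, isFundamentalDomain_square_squareGroup, h⟩,
    h.mono (orbifoldEigenforms_squareGroup_subset 1)⟩

end FlatOrbifold

end

open FlatOrbifold in
theorem mainTheorem8 :
    -- the holonomy groups
    (IsCyclic rotGroup ∧ Nat.card rotGroup = 4 ∧ IsKleinFour kleinGroup) ∧
    -- both groups act properly discontinuously
    (ProperlyDiscontinuousSMul pillowGroup Plane ∧
      ProperlyDiscontinuousSMul squareGroup Plane) ∧
    -- the first quotient is a sphere whose singular points are three cone points of orders 4, 4, 2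
    (Nonempty (Underlying pillowGroup ≃ₜ Metric.sphere (0 : EuclideanSpace ℝ (Fin 3)) 1) ∧
      (∀ x : Plane, IsSingular pillowGroup x ↔
        proj pillowGroup x = proj pillowGroup !₂[0, 0] ∨
        proj pillowGroup x = proj pillowGroup !₂[1 / 2, 1 / 2] ∨
        proj pillowGroup x = proj pillowGroup !₂[1 / 2, 0]) ∧
      proj pillowGroup !₂[0, 0] ≠ proj pillowGroup !₂[1 / 2, 1 / 2] ∧
      proj pillowGroup !₂[0, 0] ≠ proj pillowGroup !₂[1 / 2, 0] ∧
      proj pillowGroup !₂[1 / 2, 1 / 2] ≠ proj pillowGroup !₂[1 / 2, 0] ∧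
      proj pillowGroup !₂[1 / 2, 0] = proj pillowGroup !₂[0, 1 / 2] ∧
      IsConePoint pillowGroup 4 !₂[0, 0] ∧
      IsConePoint pillowGroup 4 !₂[1 / 2, 1 / 2] ∧
      IsConePoint pillowGroup 2 !₂[1 / 2, 0]) ∧
    -- the second quotient is the square (isometrically), with edges reflectors and corners dihedral
    (IsHomeomorph (fun x : square => proj squareGroup x) ∧
      (∀ x ∈ square, ∀ y ∈ square, ∀ g ∈ squareGroup, dist x y ≤ dist x (g y)) ∧
      (∀ x ∈ square, (∀ i, ¬ OnEdge i x) → ¬ IsSingular squareGroup x) ∧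
      (∀ x ∈ square, (∃! i, OnEdge i x) → IsReflectorPoint squareGroup x) ∧
      (∀ x ∈ square, (∀ i, OnEdge i x) → IsDihedralPoint squareGroup 2 x)) ∧
    -- the 1-spectra of both orbifolds and of the square with absolute boundary conditions coincide
    (∃ lam : ℕ → ℝ, IsOrbifoldSpectrum 1 pillowGroup lam ∧ IsOrbifoldSpectrum 1 squareGroup lam ∧
      IsSquareAbsoluteSpectrum 1 lam) := by
  refine ⟨⟨inferInstance, card_rotGroup, isKleinFour_kleinGroup⟩,
    ⟨properlyDiscontinuousSMul_latticeSemidirect, properlyDiscontinuousSMul_latticeSemidirect⟩,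
    ⟨nonempty_homeomorph_sphere, fun _ => isSingular_pillowGroup_iff, proj_origin_ne_center,
      proj_origin_ne_edge, proj_center_ne_edge, proj_edge_eq, isConePoint_four_origin,
      isConePoint_four_center, isConePoint_two_edge⟩,
    ⟨isHomeomorph_proj_square, fun _ hx _ hy _ hg => dist_le_dist_of_mem_squareGroup hx hy hg,
      fun _ => not_isSingular_squareGroup, fun _ => isReflectorPoint_squareGroup,
      fun _ => isDihedralPoint_squareGroup⟩,
    exists_common_spectrum⟩
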